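/- Let $n\ge 2$ and let $\epsilon_1,\dots,\epsilon_n$ be the standard basis of $\mathbf Z^n$. The simple roots of type $D_n$ are $\alpha_i=\epsilon_i-\epsilon_{i+1}$ $(1\le i<n)$ and $\alpha_n=\epsilon_{n-1}+\epsilon_n$; the positive roots are $\beta_{i,k}=\epsilon_i-\epsilon_{k+1}$ $(1\le i\le k\le n-1)$ and $\gamma_{i,k}=\epsilon_i+\epsilon_k$ $(1\le i<k\le n)$; $\langle\alpha_i^\vee,\cdot\rangle$ is the standard inner product with $\alpha_i$. *Brackets.* In a sequence of brackets, cancel $()$-pairs successively until it has the form $)\cdots)(\cdots($; the brackets left over are called uncanceled. *Tableaux.* Let $J$ be the alphabet $1\prec\cdots\prec n-1\prec n,\overline n\prec\overline{n-1}\prec\cdots\prec\overline 1$, where $n$ and $\overline n$ are incomparable. Let $\mathcal T(\infty)$ be the set of tableaux with rows $R_1,\dots,R_{n-1}$ (from top to bottom) in the alphabet $J$ such that: the first column is $1,2,\dots,n-1$; rows weakly increase; the number of letters $j$ in $R_j$ is one more than the length of $R_{j+1}$ (with $R_n=\emptyset$); all entries of $R_j$ are $\preceq\overline{\jmath}$;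 no row contains both $n$ and $\overline n$. For $1\le i\le n-1$ the $i$-arrows are $i\to i+1$ and $\overline{\imath+1}\to\overline{\imath}$; the $n$-arrows are $n-1\to\overline n$ and $n\to\overline{n-1}$. Read the rows of $T$ from top to bottom, each from right to left, and write `)' for each letter which an $i$-arrow enters and `(' for each letter which an $i$-arrow leaves. Then $f_iT$ is obtained by moving the letter of the leftmost uncanceled `(' along its $i$-arrow and, if the result is not in $\mathcal T(\infty)$, inserting one column $1,\dots,\min(i,n-1)$; $e_iT$ is obtained by moving the letter of the rightmost uncanceled `)' back along its $i$-arrow and, if the result is not in $\mathcal T(\infty)$, deleting one such column; $e_iT=0$ if there is no uncanceled `)'. Let $\varepsilon_i(T)$ be the number of uncanceled `)', let $\mathrm{wt}(T)$ be the sum, over all boxes, of $\pm\epsilon_k-\epsilon_j$, where $j$ is the row of the box and the sign is $+$ if its letter is $k$, $-$ if its letter is $\overline k$, and let $\varphi_i=\varepsilon_i+\langle\alpha_i^\vee,\mathrm{wt}\rangle$. *Kostant partitions.* Let $\mathrm{Kp}(\infty)$ be the set of formal sums $\boldsymbol\alpha=\sum_\beta c_\beta(\beta)$ over the positive roots, $c_\beta\in\mathbf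 Z_{\ge0}$, with $(0)=0$. For $1\le i\le n-1$ let $\Phi_i$ be the sequence of the roots $\beta_{k,i},\beta_{k,i-1},\gamma_{k,i},\gamma_{k,i+1}$ for $k=1,\dots,i-1$ in turn, followed by $\beta_{i,i}$; let $\Phi_n$ be the sequence of the roots $\gamma_{k,n},\beta_{k,n-2},\gamma_{k,n-1},\beta_{k,n-1}$ for $k=1,\dots,n-2$ in turn, followed by $\gamma_{n-1,n}$. Going through $\Phi_i$, write $c_\beta$ brackets `)' if $\beta-\alpha_i$ is a positive root or $0$, and $c_\beta$ brackets `(' if $\beta+\alpha_i$ is a positive root. If $\beta$ is the root of the leftmost uncanceled `(', then $f_i\boldsymbol\alpha=\boldsymbol\alpha-(\beta)+(\beta+\alpha_i)$, and $f_i\boldsymbol\alpha=\boldsymbol\alpha+(\alpha_i)$ if there is none. If $\beta$ is the root of the rightmost uncanceled `)', then $e_i\boldsymbol\alpha=\boldsymbol\alpha-(\beta)+(\beta-\alpha_i)$, and $e_i\boldsymbol\alpha=0$ (the formal zero) if there is none. Let $\varepsilon_i(\boldsymbol\alpha)$ be the number of uncanceled `)', $\mathrm{wt}(\boldsymbol\alpha)=-\sum_\beta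 c_\beta\beta$ and $\varphi_i=\varepsilon_i+\langle\alpha_i^\vee,\mathrm{wt}\rangle$. **Theorem.** With these maps $\mathcal T(\infty)$ and $\mathrm{Kp}(\infty)$ are crystals of type $D_n$. There is exactly one crystal isomorphism $\Psi:\mathcal T(\infty)\to\mathrm{Kp}(\infty)$, i.e. exactly one bijection that preserves $\mathrm{wt},\varepsilon_i,\varphi_i$ and commutes with $e_i,f_i$ for all $1\le i\le n$. It is given by $\Psi(T)=\sum_{j=1}^{n-1}\Psi(R_j)$, where $\Psi(R_j)$ is the sum of the following contributions (the letters $j$ in $R_j$ are placeholders and contribute nothing): 1. each $\overline{\jmath}$ contributes $(\beta_{j,j})+(\gamma_{j,j+1})$; 2. for each $j<k\le n-1$, the letters $k$ and $\overline k$ are paired as far as possible, and each pair $k,\overline k$ contributes $(\beta_{j,k})+(\gamma_{j,k+1})$; 3. each remaining $k$ with $j<k\le n$ contributes $(\beta_{j,k-1})$; 4. each remaining $\overline k$ with $j<k\le n$ contributes $(\gamma_{j,k})$. -/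

import Mathlib

namespace TypeD

/-! ### Roots and weights of type `D_n`

All weights that occur lie in `ℤ ε_1 ⊕ ⋯ ⊕ ℤ ε_n`; they are written in the coordinates
`ε_1, …, ε_n`. Indices of `ε`, of simple roots and of rows are the usual ones, starting at `1`. -/

/-- Integral weights, in the coordinates `ε_1, …, ε_n`. -/
abbrev Weight (n : ℕ) : Type := Fin n → ℤ

/-- The basis vector `ε_i`, for `1 ≤ i ≤ n`. -/
def ep (n i : ℕ) : Weight n := fun j => if (j : ℕ) + 1 = i then 1 else 0

/-- `α_i = ε_i - ε_{i+1}` for `i < n`, and `α_n = ε_{n-1} + ε_n`. -/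
def simpleRoot (n i : ℕ) : Weight n :=
  if i = n then ep n (n - 1) + ep n n else ep n i - ep n (i + 1)

/-- `⟨α_i^∨, w⟩`; type `D_n` is simply laced, so this is the standard inner product with `α_i`. -/
def pairing (n i : ℕ) (w : Weight n) : ℤ := ∑ j, simpleRoot n i j * w j

/-- `β_{i,k} = α_i + ⋯ + α_k = ε_i - ε_{k+1}`. -/
def beta (n i k : ℕ) : Weight n := ep n i - ep n (k + 1)

/-- `γ_{i,k} = (α_i + ⋯ + α_{n-2}) + α_n + (α_{n-1} + ⋯ + α_k) = ε_i + ε_k`. -/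
def gamma (n i k : ℕ) : Weight n := ep n i + ep n k

/-- The positive roots: `β_{i,k}` for `1 ≤ i ≤ k ≤ n-1` and `γ_{i,k}` for `1 ≤ i < k ≤ n`. -/
def posRoots (n : ℕ) : Finset (Weight n) :=
  ((Finset.Icc 1 (n - 1) ×ˢ Finset.Icc 1 (n - 1)).filter (fun p => p.1 ≤ p.2)).image
      (fun p => beta n p.1 p.2) ∪
    ((Finset.Icc 1 n ×ˢ Finset.Icc 1 n).filter (fun p => p.1 < p.2)).image
      (fun p => gamma n p.1 p.2)

/-! ### Crystals -/

/-- The maps of a crystal of type `D_n` on a set `B`. The value `none` is the formal zero.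
Only the indices `1 ≤ i ≤ n` are meaningful. -/
structure CrystalData (n : ℕ) (B : Type) where
  wt : B → Weight n
  eps : ℕ → B → ℤ
  phi : ℕ → B → ℤ
  e : ℕ → B → Option B
  f : ℕ → B → Option B

/-- Kashiwara's axioms for a crystal (with integral `ε_i`, `φ_i`). -/
structure CrystalData.IsCrystal {n : ℕ} {B : Type} (C : CrystalData n B) : Prop where
  phi_eq : ∀ i, 1 ≤ i → i ≤ n → ∀ b, C.phi i b = C.eps i b + pairing n i (C.wt b)
  of_e : ∀ i, 1 ≤ i → i ≤ n → ∀ b b', C.e i b = some b' →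
    C.wt b' = C.wt b + simpleRoot n i ∧ C.eps i b' = C.eps i b - 1 ∧ C.phi i b' = C.phi i b + 1
  of_f : ∀ i, 1 ≤ i → i ≤ n → ∀ b b', C.f i b = some b' →
    C.wt b' = C.wt b - simpleRoot n i ∧ C.eps i b' = C.eps i b + 1 ∧ C.phi i b' = C.phi i b - 1
  f_iff_e : ∀ i, 1 ≤ i → i ≤ n → ∀ b b', C.f i b = some b' ↔ C.e i b' = some b

/-- `F` is an isomorphism of crystals: a bijection that preserves `wt`, `ε_i`, `φ_i` and commutes
with all `e_i`, `f_i` (where `F` sends the formal zero to the formal zero). -/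
structure IsCrystalIso {n : ℕ} {B B' : Type} (C : CrystalData n B) (C' : CrystalData n B')
    (F : B → B') : Prop where
  bijective : Function.Bijective F
  wt_eq : ∀ b, C'.wt (F b) = C.wt b
  eps_eq : ∀ i, 1 ≤ i → i ≤ n → ∀ b, C'.eps i (F b) = C.eps i b
  phi_eq : ∀ i, 1 ≤ i → i ≤ n → ∀ b, C'.phi i (F b) = C.phi i b
  e_eq : ∀ i, 1 ≤ i → i ≤ n → ∀ b, C'.e i (F b) = (C.e i b).map F
  f_eq : ∀ i, 1 ≤ i → i ≤ n → ∀ b, C'.f i (F b) = (C.f i b).map F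

/-! ### Cancellation of brackets -/

/-- `opening` is `(` and `closing` is `)`. -/
inductive Bracket
  | opening
  | closing
  deriving DecidableEq

/-- One step of the cancellation, reading a bracket sequence from left to right. The state consists
of the uncanceled `)` and the uncanceled `(` so far, each in order of occurrence; a new `)` cancels
the last uncanceled `(`, if there is one. -/
def cancelStep {A : Type} (s : List A × List A) (b : Bracket × A) : List A × List A :=
  match b.1 with
  | .opening => (s.1, s.2 ++ [b.2])
  | .closing => if s.2.isEmpty then (s.1 ++ [b.2], []) else (s.1, s.2.dropLast)

/-- The labels of the uncanceled `)` and of the uncanceled `(`, each from left to right, after all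
`()`-pairs of a sequence of labelled brackets have been successively canceled. -/
def uncanceled {A : Type} (l : List (Bracket × A)) : List A × List A :=
  l.foldl cancelStep ([], [])

/-! ### Marginally large tableaux -/

/-- Letters: `pos k` is `k` and `neg k` is `k` with a bar. -/
inductive Letter
  | pos (k : ℕ)
  | neg (k : ℕ)
  deriving DecidableEq

open Letter

/-- The letters of the alphabet `J(D_n)`. -/
def Letter.InAlphabet (n : ℕ) : Letter → Prop
  | pos k => 1 ≤ k ∧ k ≤ n
  | neg k => 1 ≤ k ∧ k ≤ n

/-- Height of a letter in `1 ≺ ⋯ ≺ n-1 ≺ n, n̄ ≺ (n-1)̄ ≺ ⋯ ≺ 1̄`; only `n` and `n̄` have the same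
height. -/
def Letter.height (n : ℕ) : Letter → ℕ
  | pos k => k
  | neg k => 2 * n - k

/-- The partial order `≼` on `J(D_n)`, in which `n` and `n̄` are incomparable. -/
def Letter.Le (n : ℕ) (x y : Letter) : Prop := x = y ∨ x.height n < y.height n

/-- The end of the `i`-arrow that leaves a letter in the fundamental crystal
`1 → ⋯ → n-1 → n, n̄ → (n-1)̄ → ⋯ → 1̄`, if there is such an arrow. -/
def Letter.next (n i : ℕ) : Letter → Option Letter
  | pos k =>
    if i < n ∧ k = i then some (pos (i + 1))
    else if i = n ∧ k = n - 1 then some (neg n)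
    else if i = n ∧ k = n then some (neg (n - 1))
    else none
  | neg k => if i < n ∧ k = i + 1 then some (neg i) else none

/-- The origin of the `i`-arrow that enters a letter in the fundamental crystal, if there is such
an arrow. -/
def Letter.prev (n i : ℕ) : Letter → Option Letter
  | pos k => if i < n ∧ k = i + 1 then some (pos i) else none
  | neg k =>
    if i < n ∧ k = i then some (neg (i + 1))
    else if i = n ∧ k = n then some (pos (n - 1))
    else if i = n ∧ k = n - 1 then some (pos n)
    else none

/-- The rows of a filling: `R j` is the `j`-th row from the top, read from left to right. -/
abbrev Filling : Type := ℕ → List Letter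

/-- `R` is a marginally large tableau of type `D_n`, with rows `1, …, n-1`. -/
structure IsMarginallyLarge (n : ℕ) (R : Filling) : Prop where
  rows : ∀ j, ¬ (1 ≤ j ∧ j < n) → R j = []
  alphabet : ∀ j, ∀ x ∈ R j, x.InAlphabet n
  first_column : ∀ j, 1 ≤ j → j < n → (R j).head? = some (pos j)
  weakly_increasing : ∀ j, (R j).Pairwise (Letter.Le n)
  marginal : ∀ j, 1 ≤ j → j < n → (R j).count (pos j) = (R (j + 1)).length + 1
  bounded : ∀ j, ∀ x ∈ R j, x.Le n (neg j)
  not_both : ∀ j, ¬ (pos n ∈ R j ∧ neg n ∈ R j)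

/-- The set `T(∞)` of marginally large tableaux of type `D_n`. -/
abbrev MLT (n : ℕ) : Type := {R : Filling // IsMarginallyLarge n R}

/-- The boxes, as triples (row, column, letter), in the order of the reading word: rows from top to
bottom, each row from right to left. Columns are numbered from `0`. -/
def boxes (n : ℕ) (R : Filling) : List (ℕ × ℕ × Letter) :=
  (List.range' 1 (n - 1)).flatMap
    (fun j => ((R j).zipIdx.map (fun p => (j, p.2, p.1))).reverse)

/-- The bracketing sequence `br_i`, each bracket labelled by its box. -/
def brackets (n i : ℕ) (R : Filling) : List (Bracket × (ℕ × ℕ × Letter)) :=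
  (boxes n R).filterMap (fun b =>
    if (b.2.2.prev n i).isSome then some (Bracket.closing, b)
    else if (b.2.2.next n i).isSome then some (Bracket.opening, b)
    else none)

/-- Replace the letter of the box in row `j` and column `c` by `x`. -/
def setBox (R : Filling) (j c : ℕ) (x : Letter) : Filling :=
  Function.update R j ((R j).set c x)

/-- Insert a column with the entries `1, 2, …, i` (`1, …, n-1` if `i = n`). -/
def insertColumn (n i : ℕ) (R : Filling) : Filling :=
  fun j => if 1 ≤ j ∧ j ≤ i ∧ j < n then pos j :: R j else R j

/-- Delete a column with the entries `1, 2, …, i` (`1, …, n-1` if `i = n`): row `j` loses one of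
the letters `j` with which it starts. -/
def deleteColumn (n i : ℕ) (R : Filling) : Filling :=
  fun j => if 1 ≤ j ∧ j ≤ i ∧ j < n then (R j).tail else R j

open Classical in
/-- `R` if it is a marginally large tableau, otherwise the correction `R'`. -/
noncomputable def correct (n : ℕ) (R R' : Filling) : Option (MLT n) :=
  if h : IsMarginallyLarge n R then some ⟨R, h⟩
  else if h' : IsMarginallyLarge n R' then some ⟨R', h'⟩
  else none

/-- `e_i` on tableaux: acts on the box of the rightmost uncanceled `)`. -/
noncomputable def tabE (n i : ℕ) (T : MLT n) : Option (MLT n) :=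
  (uncanceled (brackets n i T.1)).1.getLast?.bind (fun b =>
    (b.2.2.prev n i).bind (fun x =>
      correct n (setBox T.1 b.1 b.2.1 x) (deleteColumn n i (setBox T.1 b.1 b.2.1 x))))

/-- `f_i` on tableaux: acts on the box of the leftmost uncanceled `(`. -/
noncomputable def tabF (n i : ℕ) (T : MLT n) : Option (MLT n) :=
  (uncanceled (brackets n i T.1)).2.head?.bind (fun b =>
    (b.2.2.next n i).bind (fun x =>
      correct n (setBox T.1 b.1 b.2.1 x) (insertColumn n i (setBox T.1 b.1 b.2.1 x))))

/-- The weight of a letter: `ε_k` for `k` and `-ε_k` for `k̄`. -/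
def Letter.weight (n : ℕ) : Letter → Weight n
  | pos k => ep n k
  | neg k => - ep n k

/-- The weight of a tableau: the weights of all letters, minus those of the tableau of the same
shape in which all letters in row `j` are `j`. -/
def tabWt (n : ℕ) (R : Filling) : Weight n :=
  ∑ j ∈ Finset.Icc 1 (n - 1), ((R j).map (fun x => x.weight n - ep n j)).sum

/-- The number of uncanceled `)` in `br_i`. -/
def tabEps (n i : ℕ) (R : Filling) : ℤ := ((uncanceled (brackets n i R)).1.length : ℤ)

/-- The crystal `T(∞)`. -/
noncomputable def tabCrystal (n : ℕ) : CrystalData n (MLT n) where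
  wt T := tabWt n T.1
  eps i T := tabEps n i T.1
  phi i T := tabEps n i T.1 + pairing n i (tabWt n T.1)
  e i T := tabE n i T
  f i T := tabF n i T

/-! ### Kostant partitions -/

/-- Kostant partitions `∑ c_β (β)`, given by their coefficients `c_β ∈ ℤ_{≥0}`, `β ∈ Φ⁺`
(a finite set). -/
abbrev Kp (n : ℕ) : Type := {v : Weight n // v ∈ posRoots n} → ℕ

/-- The Kostant partition `(v)` if `v` is a positive root, and `0` otherwise; so `(0) = 0`. -/
def part (n : ℕ) (v : Weight n) : Kp n := fun b => if b.1 = v then 1 else 0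

/-- The coefficient `c_v` (zero if `v` is not a positive root). -/
def coeff (n : ℕ) (a : Kp n) (v : Weight n) : ℕ := if h : v ∈ posRoots n then a ⟨v, h⟩ else 0

/-- The roots in `Φ_i`, in increasing order. -/
def rootList (n i : ℕ) : List (Weight n) :=
  if i = n then
    (List.range' 1 (n - 2)).flatMap
      (fun k => [gamma n k n, beta n k (n - 2), gamma n k (n - 1), beta n k (n - 1)])
      ++ [gamma n (n - 1) n]
  else
    (List.range' 1 (i - 1)).flatMap
      (fun k => [beta n k i, beta n k (i - 1), gamma n k i, gamma n k (i + 1)])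
      ++ [beta n i i]

/-- The bracketing sequence `S_i`, each bracket labelled by its root: `c_v` brackets `)` if
`v - α_i` is a positive root or zero, `c_v` brackets `(` if `v + α_i` is a positive root. -/
def kpBrackets (n i : ℕ) (a : Kp n) : List (Bracket × Weight n) :=
  (rootList n i).flatMap (fun v =>
    if v - simpleRoot n i ∈ posRoots n ∨ v = simpleRoot n i then
      List.replicate (coeff n a v) (Bracket.closing, v)
    else if v + simpleRoot n i ∈ posRoots n then
      List.replicate (coeff n a v) (Bracket.opening, v)
    else [])

/-- `e_i` on Kostant partitions. -/
def kpE (n i : ℕ) (a : Kp n) : Option (Kp n) :=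
  (uncanceled (kpBrackets n i a)).1.getLast?.map (fun v =>
    a - part n v + part n (v - simpleRoot n i))

/-- `f_i` on Kostant partitions. -/
def kpF (n i : ℕ) (a : Kp n) : Kp n :=
  match (uncanceled (kpBrackets n i a)).2.head? with
  | some v => a - part n v + part n (v + simpleRoot n i)
  | none => a + part n (simpleRoot n i)

/-- `wt(∑ c_β (β)) = -∑ c_β β`. -/
def kpWt (n : ℕ) (a : Kp n) : Weight n := - ∑ b, a b • b.1

/-- The number of uncanceled `)` in `S_i`. -/
def kpEps (n i : ℕ) (a : Kp n) : ℤ := ((uncanceled (kpBrackets n i a)).1.length : ℤ)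

/-- The crystal `Kp(∞)`. -/
def kpCrystal (n : ℕ) : CrystalData n (Kp n) where
  wt a := kpWt n a
  eps i a := kpEps n i a
  phi i a := kpEps n i a + pairing n i (kpWt n a)
  e i a := kpE n i a
  f i a := some (kpF n i a)

/-! ### The map from tableaux to Kostant partitions -/

/-- The number of pairs `k, k̄` in a row. -/
def pairs (r : List Letter) (k : ℕ) : ℕ := min (r.count (pos k)) (r.count (neg k))

/-- The image of a row `r` in position `j`. The letters `j` in row `j` are placeholders and
contribute nothing; a row never contains both `n` and `n̄`. -/
def psiRow (n j : ℕ) (r : List Letter) : Kp n :=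
  r.count (neg j) • (part n (beta n j j) + part n (gamma n j (j + 1)))
    + ∑ k ∈ Finset.Icc (j + 1) (n - 1),
        pairs r k • (part n (beta n j k) + part n (gamma n j (k + 1)))
    + ∑ k ∈ Finset.Icc (j + 1) n, (r.count (pos k) - pairs r k) • part n (beta n j (k - 1))
    + ∑ k ∈ Finset.Icc (j + 1) n, (r.count (neg k) - pairs r k) • part n (gamma n j k)

/-- `Ψ(T)` is the sum of the images of the rows of `T`. -/
def psi (n : ℕ) (T : MLT n) : Kp n := ∑ j ∈ Finset.Icc 1 (n - 1), psiRow n j (T.1 j)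

end TypeD

/-!
Bracket sequences up to cancellation multiply in the bicyclic monoid. The key dictionary sends a
letter `z` of row `j` to the root `ε_j - wt z`: it turns `k` into `β_{j,k-1}` and `k̄` into
`γ_{j,k}`, and `f_i` moves both letters and roots along the arrows `s → t` and `t̄ → s̄` of colour
`i`. In a row `j < s` of a tableau, the brackets are those of the upper arrow followed by those of
the lower one, and in the Kostant partition it is the other way round; replacing the pairs `k, k̄`
by `(β_{j,k}) + (γ_{j,k+1})` compensates for this, so that both have the same uncanceled brackets.
Hence `f_i` and `e_i` act in the same row on both sides, and `Ψ` commutes with them.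

A row `R_j` is recovered from `Ψ(R_j)` by counting its letters with index `k = n, n - 1, …`, since
the pairs with index `k` are counted by the multiplicities of index `k + 1`; so `Ψ` is injective.
Every nonzero Kostant partition has some `e_i ≠ 0`, so it is obtained from `0` by the operators
`f_i`; this gives both the surjectivity and the uniqueness of `Ψ`.
-/

namespace TypeD

open Letter

/-! ### The bicyclic monoid -/

/-- The bicyclic monoid. The element `⟨c, o⟩` stands for the reduced bracket sequence with `c`
brackets `)` followed by `o` brackets `(`, and the product is concatenation followed by
cancellation. -/
@[ext]
structure Bicyclic where
  closing : ℕ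
  opening : ℕ

namespace Bicyclic

instance : One Bicyclic := ⟨⟨0, 0⟩⟩

instance : Mul Bicyclic :=
  ⟨fun p q => ⟨p.closing + (q.closing - p.opening), (p.opening - q.closing) + q.opening⟩⟩

@[simp] theorem one_closing : (1 : Bicyclic).closing = 0 := rfl

@[simp] theorem one_opening : (1 : Bicyclic).opening = 0 := rfl

@[simp] theorem mul_closing (p q : Bicyclic) :
    (p * q).closing = p.closing + (q.closing - p.opening) := rfl

@[simp] theorem mul_opening (p q : Bicyclic) :
    (p * q).opening = (p.opening - q.closing) + q.opening := rfl

instance : Monoid Bicyclic where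
  mul_assoc p q r := by
    ext <;> simp only [mul_closing, mul_opening] <;> omega
  one_mul p := by ext <;> simp
  mul_one p := by ext <;> simp

/-- `p • y` is the number of uncanceled `)` in a sequence `p` that is followed by `y` brackets
`)`. -/
instance : MulAction Bicyclic ℕ where
  smul p y := p.closing + (y - p.opening)
  one_smul y := by change 0 + (y - 0) = y; omega
  mul_smul p q y := by
    change (p * q).closing + (y - (p * q).opening) =
      p.closing + (q.closing + (y - q.opening) - p.opening)
    simp only [mul_closing, mul_opening]
    omega

theorem smul_def (p : Bicyclic) (y : ℕ) : p • y = p.closing + (y - p.opening) := rfl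

theorem closing_mul (p q : Bicyclic) : (p * q).closing = p • q.closing := rfl

end Bicyclic

section Cancellation

variable {A : Type}

theorem uncanceled_concat (l : List (Bracket × A)) (b : Bracket × A) :
    uncanceled (l ++ [b]) = cancelStep (uncanceled l) b := by
  simp [uncanceled]

theorem uncanceled_append (l₁ l₂ : List (Bracket × A)) :
    uncanceled (l₁ ++ l₂) =
      ((uncanceled l₁).1 ++ (uncanceled l₂).1.drop (uncanceled l₁).2.length,
        (uncanceled l₁).2.take ((uncanceled l₁).2.length - (uncanceled l₂).1.length)
          ++ (uncanceled l₂).2) := by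
  induction l₂ using List.reverseRecOn with
  | nil => simp [uncanceled]
  | append_singleton l b ih =>
    rw [← List.append_assoc, uncanceled_concat, ih, uncanceled_concat]
    obtain ⟨b, x⟩ := b
    generalize (uncanceled l₁).1 = c, (uncanceled l₁).2 = o, uncanceled l = u
    obtain ⟨c', o'⟩ := u
    cases b with
    | opening => simp [cancelStep]
    | closing =>
      rcases List.eq_nil_or_concat' o' with rfl | ⟨o'', y, rfl⟩
      · rcases le_or_gt o.length c'.length with h | h
        · simp [cancelStep, List.drop_append_of_le_length h, Nat.sub_eq_zero_of_le h,
            Nat.sub_eq_zero_of_le (Nat.le_succ_of_le h)]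
        · have ho : (o.take (o.length - c'.length)).isEmpty = false := by
            rw [List.isEmpty_eq_false_iff, ne_eq, ← List.length_eq_zero_iff, List.length_take]
            omega
          have hc : (c' ++ [x]).length ≤ o.length := by
            rw [List.length_append]
            exact h
          simp only [cancelStep, List.append_nil, ho, Bool.false_eq_true, ↓reduceIte,
            List.isEmpty_nil, List.drop_eq_nil_of_le h.le, List.drop_eq_nil_of_le hc,
            List.dropLast_eq_take, List.take_take, List.length_take, List.length_append,
            List.length_singleton, Prod.mk.injEq, List.take_eq_take_iff, true_and]
          omega
      · simp [cancelStep, ← List.append_assoc]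

theorem uncanceled_map_closing (l : List A) :
    uncanceled (l.map (Prod.mk Bracket.closing)) = (l, []) := by
  induction l using List.reverseRecOn with
  | nil => rfl
  | append_singleton l x ih => simp [uncanceled_concat, ih, cancelStep]

theorem uncanceled_map_opening (l : List A) :
    uncanceled (l.map (Prod.mk Bracket.opening)) = ([], l) := by
  induction l using List.reverseRecOn with
  | nil => rfl
  | append_singleton l x ih => simp [uncanceled_concat, ih, cancelStep]

/-- The sequence of brackets that is left over after cancellation, without its labels. -/
def signature (l : List (Bracket × A)) : Bicyclic :=
  ⟨(uncanceled l).1.length, (uncanceled l).2.length⟩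

theorem signature_append (l₁ l₂ : List (Bracket × A)) :
    signature (l₁ ++ l₂) = signature l₁ * signature l₂ := by
  ext <;> simp [signature, uncanceled_append]

theorem signature_flatMap {ι : Type*} (t : ι → List (Bracket × A)) (ks : List ι) :
    signature (ks.flatMap t) = (ks.map fun k => signature (t k)).prod := by
  induction ks with
  | nil => rfl
  | cons k ks ih => simp [signature_append, ih]

theorem head?_uncanceled_append_append {X l Z : List (Bracket × A)}
    (hX : (signature X).opening ≤ (signature l).closing)
    (hZ : (signature Z).closing < (signature l).opening) :
    (uncanceled (X ++ (l ++ Z))).2.head? = (uncanceled l).2.head? := by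
  simp only [signature] at hX hZ
  have hX' : (uncanceled X).2.length - ((uncanceled l).1.length +
      ((uncanceled Z).1.length - (uncanceled l).2.length)) = 0 := by omega
  simp only [uncanceled_append, List.length_append, List.length_drop, hX', List.take_zero,
    List.nil_append, List.head?_append, List.head?_take]
  rw [if_neg (by omega), Option.or_of_isSome]
  simpa [List.length_pos_iff] using Nat.zero_lt_of_lt hZ

theorem getLast?_uncanceled_append_append {X l Z : List (Bracket × A)}
    (hX : (signature X).opening < (signature l).closing)
    (hZ : (signature Z).closing ≤ (signature l).opening) :
    (uncanceled (X ++ (l ++ Z))).1.getLast? = (uncanceled l).1.getLast? := by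
  simp only [signature] at hX hZ
  have hl : (uncanceled l).1.drop (uncanceled X).2.length ≠ [] := by simpa using hX
  simp only [uncanceled_append, List.drop_eq_nil_of_le hZ, List.append_nil]
  rw [List.getLast?_append_of_ne_nil _ hl, List.getLast?_drop, if_neg (by omega)]

/-- The bracket sequence `)⋯)(⋯(` with the labels `c` on the brackets `)` and `o` on the brackets
`(`. Both bracketing rules produce a concatenation of such blocks. -/
def block (c o : List A) : List (Bracket × A) :=
  c.map (Prod.mk Bracket.closing) ++ o.map (Prod.mk Bracket.opening)

theorem uncanceled_block (c o : List A) : uncanceled (block c o) = (c, o) := by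
  simp [block, uncanceled_append, uncanceled_map_closing, uncanceled_map_opening]

theorem signature_block (c o : List A) : signature (block c o) = ⟨c.length, o.length⟩ := by
  simp [signature, uncanceled_block]

end Cancellation

/-! ### The block in which an operator acts -/

section Selection

variable {ι : Type*} {g g' : ι → Bicyclic} {ks : List ι} {y : ℕ} {k : ι}

/-- In a sequence of blocks `k ∈ ks` with signatures `g k`, followed by `y` brackets `)`, the
leftmost uncanceled `(` lies in the block `k`. -/
def FirstOpening (g : ι → Bicyclic) (ks : List ι) (y : ℕ) (k : ι) : Prop :=
  ∃ pre post, ks = pre ++ k :: post ∧ (pre.map g).prod.opening ≤ (g k).closing ∧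
    (post.map g).prod • y < (g k).opening

/-- In a sequence of blocks `k ∈ ks` with signatures `g k`, followed by `y` brackets `)`, the
rightmost uncanceled `)` lies in the block `k`. -/
def LastClosing (g : ι → Bicyclic) (ks : List ι) (y : ℕ) (k : ι) : Prop :=
  ∃ pre post, ks = pre ++ k :: post ∧ (pre.map g).prod.opening < (g k).closing ∧
    (post.map g).prod • y ≤ (g k).opening

theorem FirstOpening.mem (h : FirstOpening g ks y k) : k ∈ ks := by
  obtain ⟨pre, post, rfl, -⟩ := h
  simp

theorem LastClosing.mem (h : LastClosing g ks y k) : k ∈ ks := by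
  obtain ⟨pre, post, rfl, -⟩ := h
  simp

theorem FirstOpening.opening_pos (h : FirstOpening g ks y k) : 0 < (g k).opening := by
  obtain ⟨pre, post, -, -, h⟩ := h
  omega

theorem LastClosing.closing_pos (h : LastClosing g ks y k) : 0 < (g k).closing := by
  obtain ⟨pre, post, -, h, -⟩ := h
  omega

theorem opening_prod_le_or_exists_firstOpening (g : ι → Bicyclic) (ks : List ι) (y : ℕ) :
    (ks.map g).prod.opening ≤ y ∨ ∃ k, FirstOpening g ks y k := by
  induction ks with
  | nil => simp
  | cons k ks ih =>
    by_cases hk : (ks.map g).prod • y < (g k).opening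
    · exact Or.inr ⟨k, [], ks, rfl, by simp, hk⟩
    rcases ih with ih | ⟨m, pre, post, rfl, hpre, hpost⟩
    · left
      simp only [List.map_cons, List.prod_cons, Bicyclic.mul_opening, Bicyclic.smul_def] at hk ⊢
      omega
    · refine Or.inr ⟨m, k :: pre, post, rfl, ?_, hpost⟩
      simp only [List.map_append, List.map_cons, List.prod_append, List.prod_cons, mul_smul,
        Bicyclic.mul_opening, Bicyclic.smul_def] at hk hpost ⊢
      omega

theorem opening_prod_lt_or_exists_lastClosing (g : ι → Bicyclic) (ks : List ι) (y : ℕ) :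
    (ks.map g).prod.opening < y ∨ (∃ k, LastClosing g ks y k) ∨ (ks.map g).prod • y = 0 := by
  induction ks with
  | nil =>
    simp only [List.map_nil, List.prod_nil, Bicyclic.one_opening, one_smul]
    omega
  | cons k ks ih =>
    by_cases hk : (ks.map g).prod • y ≤ (g k).opening
    · by_cases h0 : (g k).closing = 0
      · right; right
        simp only [List.map_cons, List.prod_cons, mul_smul, Bicyclic.smul_def] at hk ⊢
        omega
      · exact Or.inr (Or.inl ⟨k, [], ks, rfl, by simpa [Nat.pos_iff_ne_zero], hk⟩)
    rcases ih with ih | ⟨m, pre, post, rfl, hpre, hpost⟩ | ih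
    · left
      simp only [List.map_cons, List.prod_cons, Bicyclic.mul_opening, Bicyclic.smul_def] at hk ⊢
      omega
    · refine Or.inr (Or.inl ⟨m, k :: pre, post, rfl, ?_, hpost⟩)
      simp only [List.map_append, List.map_cons, List.prod_append, List.prod_cons, mul_smul,
        Bicyclic.mul_opening, Bicyclic.smul_def] at hk hpost ⊢
      omega
    · omega

theorem FirstOpening.congr (hg : ∀ m ∈ ks, g m = g' m) (h : FirstOpening g ks y k) :
    FirstOpening g' ks y k := by
  obtain ⟨pre, post, rfl, hpre, hpost⟩ := h
  rw [List.map_congr_left fun m hm => hg m (by simp [hm]), hg k (by simp)] at hpre hpost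
  exact ⟨pre, post, rfl, hpre, hpost⟩

theorem LastClosing.congr (hg : ∀ m ∈ ks, g m = g' m) (h : LastClosing g ks y k) :
    LastClosing g' ks y k := by
  obtain ⟨pre, post, rfl, hpre, hpost⟩ := h
  rw [List.map_congr_left fun m hm => hg m (by simp [hm]), hg k (by simp)] at hpre hpost
  exact ⟨pre, post, rfl, hpre, hpost⟩

/-- `g'` arises from `g` by turning a `(` of the block `k` into a `)`. -/
structure Flip (g g' : ι → Bicyclic) (ks : List ι) (k : ι) : Prop where
  closing_eq : (g' k).closing = (g k).closing + 1
  opening_eq : (g k).opening = (g' k).opening + 1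
  eq_of_ne : ∀ m ∈ ks, m ≠ k → g m = g' m

theorem Flip.map_eq {pre post : List ι} (hf : Flip g g' (pre ++ k :: post) k)
    (hn : (pre ++ k :: post).Nodup) : pre.map g = pre.map g' ∧ post.map g = post.map g' := by
  have hk : k ∉ pre ++ post := (List.nodup_middle.1 hn).notMem
  rw [List.mem_append, not_or] at hk
  constructor <;> refine List.map_congr_left fun m hm => hf.eq_of_ne m (by simp [hm]) ?_
  · rintro rfl; exact hk.1 hm
  · rintro rfl; exact hk.2 hm

theorem Flip.firstOpening_iff_lastClosing (hf : Flip g g' ks k) (hn : ks.Nodup) :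
    FirstOpening g ks y k ↔ LastClosing g' ks y k := by
  constructor <;> rintro ⟨pre, post, rfl, hpre, hpost⟩ <;>
    refine ⟨pre, post, rfl, ?_⟩ <;>
    obtain ⟨epre, epost⟩ := hf.map_eq hn <;>
    have := hf.closing_eq <;>
    have := hf.opening_eq
  · rw [← epre, ← epost]; omega
  · rw [epre, epost]; omega

theorem FirstOpening.prod_smul_flip (h : FirstOpening g ks y k) (hf : Flip g g' ks k)
    (hn : ks.Nodup) : (ks.map g').prod • y = (ks.map g).prod • y + 1 := by
  obtain ⟨pre, post, rfl, hpre, hpost⟩ := h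
  obtain ⟨epre, epost⟩ := hf.map_eq hn
  have := hf.closing_eq
  have := hf.opening_eq
  simp only [List.map_append, List.map_cons, List.prod_append, List.prod_cons, mul_smul, ← epre,
    ← epost]
  generalize (post.map g).prod • y = z at *
  simp only [Bicyclic.smul_def]
  omega

/-! If each row `j` consists of two blocks `u j` and `v j`, the block in which an operator acts is
found by first selecting the row. -/

section TwoBlocks

variable {js : List ℕ} {u v : ℕ → ι} {j : ℕ}

theorem prod_map_flatMap_pair (g : ι → Bicyclic) (js : List ℕ) (u v : ℕ → ι) :
    ((js.flatMap fun j => [u j, v j]).map g).prod =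
      (js.map fun j => g (u j) * g (v j)).prod := by
  induction js with
  | nil => rfl
  | cons j js ih => simp [ih, mul_assoc]

theorem FirstOpening.fst_of_row (h : FirstOpening (fun j => g (u j) * g (v j)) js y j)
    (huv : (g (v j)).closing < (g (u j)).opening) :
    FirstOpening g (js.flatMap fun j => [u j, v j]) y (u j) := by
  obtain ⟨pre, post, rfl, hpre, hpost⟩ := h
  refine ⟨pre.flatMap fun j => [u j, v j], v j :: post.flatMap fun j => [u j, v j],
    by simp, ?_⟩
  rw [List.map_cons, List.prod_cons, mul_smul, prod_map_flatMap_pair, prod_map_flatMap_pair]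
  simp only [Bicyclic.mul_closing, Bicyclic.mul_opening] at hpre hpost
  rw [Bicyclic.smul_def (g (v j))]
  omega

theorem FirstOpening.snd_of_row (h : FirstOpening (fun j => g (u j) * g (v j)) js y j)
    (huv : (g (u j)).opening ≤ (g (v j)).closing) :
    FirstOpening g (js.flatMap fun j => [u j, v j]) y (v j) := by
  obtain ⟨pre, post, rfl, hpre, hpost⟩ := h
  refine ⟨(pre.flatMap fun j => [u j, v j]) ++ [u j], post.flatMap fun j => [u j, v j],
    by simp, ?_⟩
  rw [List.map_append, List.prod_append, prod_map_flatMap_pair, prod_map_flatMap_pair]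
  simp only [Bicyclic.mul_closing, Bicyclic.mul_opening, List.map_cons, List.map_nil,
    List.prod_singleton] at hpre hpost ⊢
  omega

end TwoBlocks

variable {A : Type} {t : ι → List (Bracket × A)} {Y : List (Bracket × A)}

theorem FirstOpening.head?_uncanceled (h : FirstOpening g ks y k)
    (hg : ∀ m ∈ ks, signature (t m) = g m) (hY : (signature Y).closing = y) :
    (uncanceled (ks.flatMap t ++ Y)).2.head? = (uncanceled (t k)).2.head? := by
  obtain ⟨pre, post, rfl, hpre, hpost⟩ := h.congr fun m hm => (hg m hm).symm
  rw [← signature_flatMap] at hpre hpost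
  rw [← hY, ← Bicyclic.closing_mul, ← signature_append] at hpost
  simpa using head?_uncanceled_append_append hpre hpost

theorem LastClosing.getLast?_uncanceled (h : LastClosing g ks y k)
    (hg : ∀ m ∈ ks, signature (t m) = g m) (hY : (signature Y).closing = y) :
    (uncanceled (ks.flatMap t ++ Y)).1.getLast? = (uncanceled (t k)).1.getLast? := by
  obtain ⟨pre, post, rfl, hpre, hpost⟩ := h.congr fun m hm => (hg m hm).symm
  rw [← signature_flatMap] at hpre hpost
  rw [← hY, ← Bicyclic.closing_mul, ← signature_append] at hpost
  simpa using getLast?_uncanceled_append_append hpre hpost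

end Selection

/-! ### Roots and letters -/

namespace Letter

/-- The index `k` of the letters `k` and `k̄`. -/
def idx : Letter → ℕ
  | pos k => k
  | neg k => k

/-- The sign of the weight of a letter: `1` for `k` and `-1` for `k̄`. -/
def sign : Letter → ℤ
  | pos _ => 1
  | neg _ => -1

/-- The duality `k ↔ k̄` of the alphabet, which reverses the arrows. -/
def bar : Letter → Letter
  | pos k => neg k
  | neg k => pos k

@[simp] theorem idx_pos (k : ℕ) : (pos k).idx = k := rfl

@[simp] theorem idx_neg (k : ℕ) : (neg k).idx = k := rfl

@[simp] theorem sign_pos (k : ℕ) : (pos k).sign = 1 := rfl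

@[simp] theorem sign_neg (k : ℕ) : (neg k).sign = -1 := rfl

@[simp] theorem bar_pos (k : ℕ) : (pos k).bar = neg k := rfl

@[simp] theorem bar_neg (k : ℕ) : (neg k).bar = pos k := rfl

@[simp] theorem idx_bar (z : Letter) : z.bar.idx = z.idx := by cases z <;> rfl

@[simp] theorem sign_bar (z : Letter) : z.bar.sign = -z.sign := by cases z <;> rfl

@[simp] theorem bar_bar (z : Letter) : z.bar.bar = z := by cases z <;> rfl

theorem bar_ne_self (z : Letter) : z.bar ≠ z := by cases z <;> simp

theorem sign_eq_one_or (z : Letter) : z.sign = 1 ∨ z.sign = -1 := by cases z <;> simp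

theorem eq_or_eq_bar_of_idx_eq {z z' : Letter} (h : z.idx = z'.idx) : z = z' ∨ z = z'.bar := by
  cases z <;> cases z' <;> simp_all

theorem weight_eq (n : ℕ) (z : Letter) : z.weight n = z.sign • ep n z.idx := by
  cases z <;> simp [weight]

theorem weight_bar (n : ℕ) (z : Letter) : z.bar.weight n = -z.weight n := by
  simp [weight_eq]

theorem ext_idx_sign {z z' : Letter} (hi : z.idx = z'.idx) (hs : z.sign = z'.sign) : z = z' := by
  cases z <;> cases z' <;> simp_all

end Letter

/-- The weight `ε_j` minus the weight of a letter. The root `β_{j,k}` belongs to the letter `k + 1`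
and `γ_{j,k}` to the letter `k̄`, so that `f_i` acts on the letters and on the roots of a row along
the same arrows. -/
def root (n j : ℕ) (z : Letter) : Weight n := ep n j - z.weight n

/-- The pairs of a row `j` and a letter `z` for which `root n j z` is a positive root. -/
def IsRoot (n j : ℕ) (z : Letter) : Prop := 1 ≤ j ∧ j < z.idx ∧ z.idx ≤ n

section Roots

variable {n j m : ℕ} {z z' : Letter} {v : Weight n}

theorem beta_eq_root (n j k : ℕ) : beta n j k = root n j (pos (k + 1)) := rfl

theorem gamma_eq_root (n j k : ℕ) : gamma n j k = root n j (neg k) := by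
  simp [gamma, root, Letter.weight]

theorem mem_posRoots : v ∈ posRoots n ↔ ∃ j z, IsRoot n j z ∧ v = root n j z := by
  simp only [posRoots, Finset.mem_union, Finset.mem_image, Finset.mem_filter, Finset.mem_product,
    Finset.mem_Icc, Prod.exists, IsRoot]
  constructor
  · rintro (⟨j, k, ⟨⟨hj, hk⟩, hjk⟩, rfl⟩ | ⟨j, k, ⟨⟨hj, hk⟩, hjk⟩, rfl⟩)
    · exact ⟨j, pos (k + 1), by rw [idx_pos]; omega, rfl⟩
    · exact ⟨j, neg k, by rw [idx_neg]; omega, gamma_eq_root n j k⟩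
  · rintro ⟨j, k | k, ⟨h1, h2, h3⟩, rfl⟩ <;> simp only [idx_pos, idx_neg] at h2 h3
    · refine Or.inl ⟨j, k - 1, by omega, ?_⟩
      rw [beta_eq_root, Nat.sub_add_cancel (by omega)]
    · exact Or.inr ⟨j, k, by omega, gamma_eq_root n j k⟩

theorem IsRoot.mem_posRoots (h : IsRoot n j z) : root n j z ∈ posRoots n :=
  TypeD.mem_posRoots.2 ⟨j, z, h, rfl⟩

theorem root_apply (hm : 1 ≤ m) (hmn : m ≤ n) :
    root n j z ⟨m - 1, by omega⟩ = (if m = j then 1 else 0) - if m = z.idx then z.sign else 0 := by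
  simp [root, ep, weight_eq, Nat.sub_add_cancel hm]

theorem root_inj {j' : ℕ} (h : IsRoot n j z) (h' : IsRoot n j' z') :
    root n j z = root n j' z' ↔ j = j' ∧ z = z' := by
  refine ⟨fun e => ?_, by rintro ⟨rfl, rfl⟩; rfl⟩
  obtain ⟨hj, hjz, hz⟩ := h
  obtain ⟨hj', hjz', hz'⟩ := h'
  have coord (m : ℕ) (hm : 1 ≤ m) (hmn : m ≤ n) :
      ((if m = j then 1 else 0) - if m = z.idx then z.sign else 0) =
        (if m = j' then 1 else 0) - if m = z'.idx then z'.sign else 0 := by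
    rw [← root_apply hm hmn, ← root_apply hm hmn, e]
  have hjj' : j = j' := by
    have hj := coord j hj ((hjz.trans_le hz).le)
    have hj' := coord j' hj' (hjz'.le.trans hz')
    split_ifs at hj hj' <;> omega
  subst hjj'
  have hzz' := coord z.idx (by omega) hz
  have hsign := z.sign_eq_one_or
  rw [if_neg (by omega : z.idx ≠ j), if_pos rfl] at hzz'
  split_ifs at hzz' with hidx
  · exact ⟨rfl, ext_idx_sign hidx (by omega)⟩
  · omega

theorem abs_apply_le_one_of_mem_posRoots (h : v ∈ posRoots n) (k : Fin n) : |v k| ≤ 1 := by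
  obtain ⟨j, z, ⟨-, hjz, -⟩, rfl⟩ := mem_posRoots.1 h
  have hk := root_apply (j := j) (z := z) (Nat.le_add_left 1 k) k.2
  have hsign := z.sign_eq_one_or
  simp only [Nat.add_sub_cancel] at hk
  rw [hk, abs_le]
  split_ifs <;> omega

theorem zero_notMem_posRoots (n : ℕ) : (0 : Weight n) ∉ posRoots n := by
  intro h
  obtain ⟨j, z, ⟨hj, hjz, hz⟩, e⟩ := mem_posRoots.1 h
  have := root_apply (z := z) (j := j) hj (hjz.trans_le hz).le
  rw [← e, if_pos rfl, if_neg (by omega)] at this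
  simp at this

end Roots

/-! ### The arrows of a given colour -/

/-- The arrows of colour `i` in the fundamental crystal are `s → t` and `t̄ → s̄`. This describes
the case `i < n`, where `s = i` and `t = i + 1`, and the case `i = n`, where `s = n - 1` and
`t = n̄`, in the same terms. -/
structure Arrows (n i s : ℕ) (t : Letter) : Prop where
  one_le : 1 ≤ s
  lt : s < n
  target_eq : t = pos (s + 1) ∨ s + 1 = n ∧ t = neg n
  next_eq : ∀ z : Letter,
    z.next n i = if z = pos s then some t else if z = t.bar then some (neg s) else none
  prev_eq : ∀ z : Letter,
    z.prev n i = if z = t then some (pos s) else if z = neg s then some t.bar else none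
  simpleRoot_eq : simpleRoot n i = root n s t
  rootList_eq : rootList n i = (List.range' 1 (s - 1)).flatMap
    (fun j => [root n j t, root n j (pos s), root n j (neg s), root n j t.bar]) ++ [root n s t]
  column_iff : ∀ j, (1 ≤ j ∧ j ≤ i ∧ j < n) ↔ (1 ≤ j ∧ j ≤ s)

theorem arrows_of_lt {n i : ℕ} (hi : 1 ≤ i) (hin : i < n) : Arrows n i i (pos (i + 1)) where
  one_le := hi
  lt := hin
  target_eq := Or.inl rfl
  next_eq z := by cases z <;> simp [Letter.next, hin, hin.ne]
  prev_eq z := by cases z <;> simp [Letter.prev, hin, hin.ne]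
  simpleRoot_eq := by simp [simpleRoot, hin.ne, root, Letter.weight]
  rootList_eq := by
    rw [rootList, if_neg hin.ne]
    simp only [beta_eq_root, gamma_eq_root, Nat.sub_add_cancel hi, bar_pos]
  column_iff j := by omega

theorem arrows_self {n : ℕ} (hn : 2 ≤ n) : Arrows n n (n - 1) (neg n) where
  one_le := by omega
  lt := by omega
  target_eq := Or.inr ⟨by omega, rfl⟩
  next_eq z := by cases z <;> simp [Letter.next]
  prev_eq z := by cases z <;> simp [Letter.prev]
  simpleRoot_eq := by simp [simpleRoot, root, Letter.weight]
  rootList_eq := by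
    have h₁ : n - 2 + 1 = n - 1 := by omega
    have h₂ : n - 1 + 1 = n := by omega
    rw [rootList, if_pos rfl, show n - 1 - 1 = n - 2 by omega]
    simp only [beta_eq_root, gamma_eq_root, bar_neg, h₁, h₂]
  column_iff j := by omega

theorem exists_arrows {n i : ℕ} (hn : 2 ≤ n) (hi : 1 ≤ i) (hin : i ≤ n) :
    ∃ s t, Arrows n i s t := by
  rcases hin.lt_or_eq with h | rfl
  · exact ⟨_, _, arrows_of_lt hi h⟩
  · exact ⟨_, _, arrows_self hn⟩

namespace Arrows

variable {n i s j : ℕ} {t : Letter}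

theorem idx_target (h : Arrows n i s t) : t.idx = s + 1 := by
  rcases h.target_eq with rfl | ⟨e, rfl⟩ <;> simp [*]

theorem isRoot_target (h : Arrows n i s t) (hj : 1 ≤ j) (hjs : j ≤ s) : IsRoot n j t :=
  ⟨hj, by rw [h.idx_target]; omega, by rw [h.idx_target]; exact h.lt⟩

theorem isRoot_bar_target (h : Arrows n i s t) (hj : 1 ≤ j) (hjs : j ≤ s) : IsRoot n j t.bar := by
  rw [IsRoot, idx_bar]
  exact h.isRoot_target hj hjs

theorem root_pos_add (h : Arrows n i s t) (j : ℕ) :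
    root n j (pos s) + simpleRoot n i = root n j t := by
  simp [h.simpleRoot_eq, root, Letter.weight]

theorem root_bar_target_add (h : Arrows n i s t) (j : ℕ) :
    root n j t.bar + simpleRoot n i = root n j (neg s) := by
  simp only [h.simpleRoot_eq, root, weight_bar, show (neg s).weight n = -ep n s from rfl]
  abel

theorem root_pos_sub_notMem (h : Arrows n i s t) (hj : j < s) :
    root n j (pos s) - simpleRoot n i ∉ posRoots n := by
  intro hm
  have := abs_apply_le_one_of_mem_posRoots hm ⟨s - 1, by have := h.lt; omega⟩
  rw [h.simpleRoot_eq, Pi.sub_apply, root_apply h.one_le h.lt.le, root_apply h.one_le h.lt.le,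
    h.idx_target] at this
  simp [hj.ne'] at this

theorem root_bar_target_sub_notMem (h : Arrows n i s t) (hj : j < s) :
    root n j t.bar - simpleRoot n i ∉ posRoots n := by
  intro hm
  have hj' : j < s + 1 := by omega
  have := abs_apply_le_one_of_mem_posRoots hm ⟨s + 1 - 1, h.lt⟩
  rw [h.simpleRoot_eq, Pi.sub_apply, root_apply (Nat.le_add_left 1 s) h.lt,
    root_apply (Nat.le_add_left 1 s) h.lt, idx_bar, h.idx_target, if_neg hj'.ne',
    if_neg s.succ_ne_self, if_pos rfl, if_pos rfl, sign_bar] at this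
  rcases t.sign_eq_one_or with e | e <;> norm_num [e] at this

end Arrows

/-! ### Coefficients of Kostant partitions -/

section Kp

variable {n j k : ℕ} {z z' : Letter} {a : Kp n} {v w : Weight n}

/-- The multiplicity of the part `root n j z`. -/
def mult (n j : ℕ) (z : Letter) : Kp n →+ ℕ where
  toFun a := coeff n a (root n j z)
  map_zero' := by simp [coeff]
  map_add' a b := by simp only [coeff]; split_ifs <;> simp

theorem mult_apply (a : Kp n) : mult n j z a = coeff n a (root n j z) := rfl

theorem mult_eq (a : Kp n) (h : IsRoot n j z) : mult n j z a = a ⟨root n j z, h.mem_posRoots⟩ := by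
  simp [mult_apply, coeff, h.mem_posRoots]

theorem mult_sub (a b : Kp n) : mult n j z (a - b) = mult n j z a - mult n j z b := by
  simp only [mult_apply, coeff]
  split_ifs <;> simp

theorem mult_part (h : IsRoot n j z) (h' : IsRoot n k z') :
    mult n j z (part n (root n k z')) = if j = k ∧ z = z' then 1 else 0 := by
  simp [mult_eq _ h, part, root_inj h h']

theorem ext_mult {b : Kp n} (h : ∀ j z, IsRoot n j z → mult n j z a = mult n j z b) : a = b := by
  funext ⟨v, hv⟩
  obtain ⟨j, z, hz, rfl⟩ := mem_posRoots.1 hv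
  simpa only [mult_eq _ hz] using h j z hz

theorem part_zero (n : ℕ) : part n 0 = 0 := by
  funext ⟨v, hv⟩
  simp [part, ne_of_mem_of_not_mem hv (zero_notMem_posRoots n)]

theorem part_le_of_mult_pos (h : IsRoot n j z) (ha : 0 < mult n j z a) :
    part n (root n j z) ≤ a := by
  intro ⟨v, hv⟩
  by_cases e : v = root n j z
  · subst e
    rw [mult_eq a h] at ha
    simp only [part, if_true]
    exact ha
  · simp [part, e]

/-- Replace a part `v` by `w`. -/
def move (n : ℕ) (a : Kp n) (v w : Weight n) : Kp n := a - part n v + part n w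

theorem move_move (h : part n v ≤ a) : move n (move n a v w) w v = a := by
  rw [move, move, add_tsub_cancel_right, tsub_add_cancel_of_le h]

theorem mult_move {j' : ℕ} {x : Letter} (a : Kp n) (hx : IsRoot n k x) (hz : IsRoot n j z)
    (hz' : IsRoot n j' z') : mult n k x (move n a (root n j z) (root n j' z')) =
      mult n k x a - (if k = j ∧ x = z then 1 else 0) + if k = j' ∧ x = z' then 1 else 0 := by
  rw [move, map_add, mult_sub, mult_part hx hz, mult_part hx hz']

/-- The map `kpWt` as a homomorphism. -/
def kpWtHom (n : ℕ) : Kp n →+ Weight n where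
  toFun := kpWt n
  map_zero' := by simp [kpWt]
  map_add' a b := by simp [kpWt, add_smul, Finset.sum_add_distrib, add_comm]

theorem kpWtHom_apply (a : Kp n) : kpWtHom n a = kpWt n a := rfl

theorem kpWt_add (a b : Kp n) : kpWt n (a + b) = kpWt n a + kpWt n b := map_add (kpWtHom n) a b

theorem kpWt_part (h : IsRoot n j z) : kpWt n (part n (root n j z)) = -root n j z := by
  rw [kpWt, Finset.sum_eq_single ⟨root n j z, h.mem_posRoots⟩]
  · simp [part]
  · intro b _ hb
    have : b.1 ≠ root n j z := fun e => hb (Subtype.ext e)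
    simp [part, this]
  · simp

theorem kpWt_move {j' : ℕ} (hz : IsRoot n j z) (hz' : IsRoot n j' z') (ha : 0 < mult n j z a) :
    kpWt n (move n a (root n j z) (root n j' z')) =
      kpWt n a + root n j z - root n j' z' := by
  have hsub := congrArg (kpWt n) (tsub_add_cancel_of_le (part_le_of_mult_pos hz ha))
  rw [kpWt_add, kpWt_part hz] at hsub
  rw [move, kpWt_add, kpWt_part hz', ← hsub]
  abel

end Kp

/-! ### Brackets of Kostant partitions -/

/-- An arrow `source → target` in a row. In the bracketing rules it contributes brackets `)` for
its target and brackets `(` for its source, where a letter `z` of row `j` stands for itself in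
tableaux and for `root n j z` in Kostant partitions. -/
structure Slot where
  row : ℕ
  source : Letter
  target : Letter

/-- The slot of the arrow `s → t` in row `j`. -/
def lowerSlot (s : ℕ) (t : Letter) (j : ℕ) : Slot := ⟨j, pos s, t⟩

/-- The slot of the arrow `t̄ → s̄` in row `j`. -/
def upperSlot (s : ℕ) (t : Letter) (j : ℕ) : Slot := ⟨j, t.bar, neg s⟩

/-- `σ` is the slot of one of the arrows `s → t` and `t̄ → s̄`, in one of the rows that contain
letters with such an arrow. -/
def IsSlot (s : ℕ) (t : Letter) (σ : Slot) : Prop :=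
  1 ≤ σ.row ∧ σ.row ≤ s ∧ (σ = lowerSlot s t σ.row ∨ σ = upperSlot s t σ.row)

/-- The slots of `Φ_i` in their order, without the last root `α_i`. -/
def kpSlots (s : ℕ) (t : Letter) : List Slot :=
  (List.range' 1 (s - 1)).flatMap fun j => [lowerSlot s t j, upperSlot s t j]

/-- The brackets of a Kostant partition in a slot. -/
def kpBlock (n : ℕ) (a : Kp n) (σ : Slot) : List (Bracket × Weight n) :=
  block (List.replicate (mult n σ.row σ.target a) (root n σ.row σ.target))
    (List.replicate (mult n σ.row σ.source a) (root n σ.row σ.source))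

/-- The signature of `kpBlock n a σ`. -/
def kpSig (n : ℕ) (a : Kp n) (σ : Slot) : Bicyclic :=
  ⟨mult n σ.row σ.target a, mult n σ.row σ.source a⟩

theorem signature_kpBlock (n : ℕ) (a : Kp n) (σ : Slot) :
    signature (kpBlock n a σ) = kpSig n a σ := by
  simp [kpBlock, signature_block, kpSig]

section KpSlots

variable {n s j : ℕ} {t : Letter} {σ τ : Slot}

theorem mem_kpSlots : σ ∈ kpSlots s t ↔
    ∃ j, 1 ≤ j ∧ j < s ∧ (σ = lowerSlot s t j ∨ σ = upperSlot s t j) := by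
  simp only [kpSlots, List.mem_flatMap, List.mem_range'_1, List.mem_cons, List.not_mem_nil,
    or_false]
  refine exists_congr fun j => ?_
  rw [← and_assoc]
  exact and_congr_left fun _ => by omega

theorem row_lt_of_mem_kpSlots (hσ : σ ∈ kpSlots s t) : σ.row < s := by
  obtain ⟨j, -, hj, rfl | rfl⟩ := mem_kpSlots.1 hσ <;> exact hj

theorem isSlot_of_mem_kpSlots (hσ : σ ∈ kpSlots s t) : IsSlot s t σ := by
  obtain ⟨j, hj, hjs, rfl | rfl⟩ := mem_kpSlots.1 hσ
  · exact ⟨hj, hjs.le, Or.inl rfl⟩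
  · exact ⟨hj, hjs.le, Or.inr rfl⟩

namespace Arrows

variable {i : ℕ}

theorem nodup_kpSlots (h : Arrows n i s t) : (kpSlots s t).Nodup := by
  have ht : t ≠ neg s := fun e => by simpa [e] using h.idx_target
  rw [kpSlots, List.nodup_flatMap]
  refine ⟨fun j _ => by simp [lowerSlot, upperSlot, ht],
    List.Pairwise.imp (fun hjk σ hσ hσ' => ?_) List.pairwise_lt_range'⟩
  simp only [lowerSlot, upperSlot, List.mem_cons, List.not_mem_nil, or_false] at hσ hσ'
  obtain rfl | rfl := hσ <;> simp [hjk.ne] at hσ'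

theorem isRoot_of_mem_kpSlots (h : Arrows n i s t) (hσ : σ ∈ kpSlots s t) :
    IsRoot n σ.row σ.source ∧ IsRoot n σ.row σ.target := by
  obtain ⟨j, hj, hjs, rfl | rfl⟩ := mem_kpSlots.1 hσ
  · exact ⟨⟨hj, hjs, h.lt.le⟩, h.isRoot_target hj hjs.le⟩
  · exact ⟨h.isRoot_bar_target hj hjs.le, ⟨hj, hjs, h.lt.le⟩⟩

theorem root_source_add (h : Arrows n i s t) (hσ : σ ∈ kpSlots s t) :
    root n σ.row σ.source + simpleRoot n i = root n σ.row σ.target := by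
  obtain ⟨j, -, -, rfl | rfl⟩ := mem_kpSlots.1 hσ
  · exact h.root_pos_add j
  · exact h.root_bar_target_add j

theorem root_source_sub_notMem (h : Arrows n i s t) (hσ : σ ∈ kpSlots s t) :
    root n σ.row σ.source - simpleRoot n i ∉ posRoots n := by
  obtain ⟨j, -, hjs, rfl | rfl⟩ := mem_kpSlots.1 hσ
  · exact h.root_pos_sub_notMem hjs
  · exact h.root_bar_target_sub_notMem hjs

theorem source_ne_target (h : Arrows n i s t) (hσ : IsSlot s t σ) : σ.source ≠ σ.target := by
  have ht := h.idx_target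
  rcases hσ with ⟨-, -, e | e⟩ <;> rw [e] <;> intro e' <;>
    simpa [lowerSlot, upperSlot, ht] using congrArg Letter.idx e'

theorem disjoint_of_ne (h : Arrows n i s t) (hσ : IsSlot s t σ) (hτ : IsSlot s t τ)
    (hne : τ ≠ σ) (hrow : τ.row = σ.row) :
    τ.source ≠ σ.source ∧ τ.source ≠ σ.target ∧ τ.target ≠ σ.source ∧ τ.target ≠ σ.target := by
  have ht := h.idx_target
  obtain ⟨-, -, hσ⟩ := hσ
  obtain ⟨-, -, hτ⟩ := hτ
  rw [hrow] at hτ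
  generalize σ.row = j at *
  rcases hσ with rfl | rfl <;> rcases hτ with rfl | rfl <;>
    simp only [ne_eq, not_true_eq_false] at hne <;>
    cases t <;> simp_all [lowerSlot, upperSlot]

theorem kpBrackets_eq (h : Arrows n i s t) (a : Kp n) : kpBrackets n i a =
    (kpSlots s t).flatMap (kpBlock n a) ++
      block (List.replicate (mult n s t a) (root n s t)) [] := by
  have slot (σ : Slot) (hσ : σ ∈ kpSlots s t) :
      root n σ.row σ.target - simpleRoot n i ∈ posRoots n ∧
        ¬ (root n σ.row σ.source - simpleRoot n i ∈ posRoots n ∨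
          root n σ.row σ.source = simpleRoot n i) ∧
        root n σ.row σ.source + simpleRoot n i ∈ posRoots n := by
    obtain ⟨hsource, htarget⟩ := h.isRoot_of_mem_kpSlots hσ
    have hne : σ.row ≠ s := (row_lt_of_mem_kpSlots hσ).ne
    rw [← h.root_source_add hσ, add_sub_cancel_right, h.root_source_add hσ, h.simpleRoot_eq,
      root_inj hsource (h.isRoot_target h.one_le le_rfl), ← h.simpleRoot_eq]
    exact ⟨hsource.mem_posRoots, by simp [h.root_source_sub_notMem hσ, hne],
      htarget.mem_posRoots⟩
  rw [kpBrackets, h.rootList_eq, List.flatMap_append, List.flatMap_assoc, kpSlots,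
    List.flatMap_assoc]
  congr 1
  · refine List.flatMap_congr fun j hj => ?_
    have hj' : 1 ≤ j ∧ j < s := by simp only [List.mem_range'_1] at hj; omega
    obtain ⟨l₁, l₂, l₃⟩ := slot _ (mem_kpSlots.2 ⟨j, hj'.1, hj'.2, Or.inl rfl⟩)
    obtain ⟨u₁, u₂, u₃⟩ := slot _ (mem_kpSlots.2 ⟨j, hj'.1, hj'.2, Or.inr rfl⟩)
    simp only [lowerSlot, upperSlot] at l₁ l₂ l₃ u₁ u₂ u₃
    simp [l₁, l₂, l₃, u₁, u₂, u₃, kpBlock, block, lowerSlot, upperSlot, mult_apply]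
  · simp [h.simpleRoot_eq, block, mult_apply]

end Arrows

end KpSlots

/-! ### The operators on Kostant partitions -/

namespace Arrows

variable {n i s : ℕ} {t : Letter} {a a' : Kp n} {σ : Slot}

theorem signature_flatMap_kpBlock (a : Kp n) (ks : List Slot) :
    signature (ks.flatMap (kpBlock n a)) = (ks.map (kpSig n a)).prod := by
  simp only [signature_flatMap, signature_kpBlock]

theorem signature_kpBrackets (h : Arrows n i s t) (a : Kp n) :
    signature (kpBrackets n i a) = ((kpSlots s t).map (kpSig n a)).prod * ⟨mult n s t a, 0⟩ := by
  simp only [h.kpBrackets_eq, signature_append, signature_flatMap_kpBlock, signature_block,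
    List.length_replicate, List.length_nil]

theorem kpEps_eq (h : Arrows n i s t) (a : Kp n) :
    kpEps n i a = (((kpSlots s t).map (kpSig n a)).prod • mult n s t a : ℕ) :=
  congrArg (fun p : Bicyclic => (p.closing : ℤ)) (h.signature_kpBrackets a)

theorem kpF_slot (h : Arrows n i s t)
    (hσ : FirstOpening (kpSig n a) (kpSlots s t) (mult n s t a) σ) :
    kpF n i a = move n a (root n σ.row σ.source) (root n σ.row σ.target) := by
  have hpos : mult n σ.row σ.source a ≠ 0 := hσ.opening_pos.ne'
  have hhead : (uncanceled (kpBrackets n i a)).2.head? = some (root n σ.row σ.source) := by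
    rw [h.kpBrackets_eq, hσ.head?_uncanceled (fun τ _ => signature_kpBlock n a τ)
      (by simp [signature_block])]
    simp [kpBlock, uncanceled_block, List.head?_replicate, hpos]
  simp [kpF, hhead, move, h.root_source_add hσ.mem]

theorem kpE_slot (h : Arrows n i s t)
    (hσ : LastClosing (kpSig n a) (kpSlots s t) (mult n s t a) σ) :
    kpE n i a = some (move n a (root n σ.row σ.target) (root n σ.row σ.source)) := by
  have hpos : mult n σ.row σ.target a ≠ 0 := hσ.closing_pos.ne'
  have hlast : (uncanceled (kpBrackets n i a)).1.getLast? = some (root n σ.row σ.target) := by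
    rw [h.kpBrackets_eq, hσ.getLast?_uncanceled (fun τ _ => signature_kpBlock n a τ)
      (by simp [signature_block])]
    simp [kpBlock, uncanceled_block, List.getLast?_replicate, hpos]
  simp [kpE, hlast, move, ← h.root_source_add hσ.mem]

theorem kpF_last (h : Arrows n i s t)
    (ha : ((kpSlots s t).map (kpSig n a)).prod.opening ≤ mult n s t a) :
    kpF n i a = a + part n (root n s t) := by
  have hnil : (uncanceled (kpBrackets n i a)).2 = [] := by
    rw [← List.length_eq_zero_iff]
    change (signature (kpBrackets n i a)).opening = 0
    rw [h.signature_kpBrackets, Bicyclic.mul_opening]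
    exact Nat.sub_eq_zero_of_le ha
  simp [kpF, hnil, h.simpleRoot_eq]

theorem kpE_last (h : Arrows n i s t)
    (ha : ((kpSlots s t).map (kpSig n a)).prod.opening < mult n s t a) :
    kpE n i a = some (a - part n (root n s t)) := by
  have hlast : (uncanceled (kpBrackets n i a)).1.getLast? = some (root n s t) := by
    have := getLast?_uncanceled_append_append (X := (kpSlots s t).flatMap (kpBlock n a))
      (l := block (List.replicate (mult n s t a) (root n s t)) []) (Z := [])
      (by simpa [signature_flatMap_kpBlock, signature_block] using ha)
      (by simp [signature, uncanceled])
    rw [List.append_nil] at this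
    simp [h.kpBrackets_eq, this, uncanceled_block, List.getLast?_replicate,
      (Nat.zero_lt_of_lt ha).ne']
  simp [kpE, hlast, h.simpleRoot_eq, part_zero]

theorem kpE_none (h : Arrows n i s t)
    (ha : ((kpSlots s t).map (kpSig n a)).prod • mult n s t a = 0) : kpE n i a = none := by
  have hnil : (uncanceled (kpBrackets n i a)).1 = [] := by
    rw [← List.length_eq_zero_iff]
    change (signature (kpBrackets n i a)).closing = 0
    rwa [h.signature_kpBrackets]
  simp [kpE, hnil]

theorem flip_move (h : Arrows n i s t) (hσ : σ ∈ kpSlots s t)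
    (ha : 0 < mult n σ.row σ.source a) : Flip (kpSig n a)
      (kpSig n (move n a (root n σ.row σ.source) (root n σ.row σ.target))) (kpSlots s t) σ := by
  obtain ⟨hsource, htarget⟩ := h.isRoot_of_mem_kpSlots hσ
  have hne := h.source_ne_target (isSlot_of_mem_kpSlots hσ)
  refine ⟨?_, ?_, fun τ hτ hτσ => ?_⟩
  · simp [kpSig, mult_move a htarget hsource htarget, hne.symm]
  · simp [kpSig, mult_move a hsource hsource htarget, hne, Nat.sub_add_cancel ha]
  · obtain ⟨hsource', htarget'⟩ := h.isRoot_of_mem_kpSlots hτ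
    have := h.disjoint_of_ne (isSlot_of_mem_kpSlots hσ) (isSlot_of_mem_kpSlots hτ) hτσ
    ext <;> simp only [kpSig, mult_move a hsource' hsource htarget,
      mult_move a htarget' hsource htarget] <;> split_ifs <;> simp_all

theorem mult_last_move (h : Arrows n i s t) {j : ℕ} {x x' : Letter} (hj : j < s)
    (hx : IsRoot n j x) (hx' : IsRoot n j x') :
    mult n s t (move n a (root n j x) (root n j x')) = mult n s t a := by
  simp [mult_move a (h.isRoot_target h.one_le le_rfl) hx hx', hj.ne']

theorem mult_last_add_part (h : Arrows n i s t) (a : Kp n) :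
    mult n s t (a + part n (root n s t)) = mult n s t a + 1 := by
  have ht := h.isRoot_target h.one_le le_rfl
  simp [mult_part ht ht]

theorem map_kpSig_add_part (h : Arrows n i s t) (a : Kp n) :
    (kpSlots s t).map (kpSig n (a + part n (root n s t))) = (kpSlots s t).map (kpSig n a) := by
  refine List.map_congr_left fun τ hτ => ?_
  obtain ⟨hsource, htarget⟩ := h.isRoot_of_mem_kpSlots hτ
  have ht := h.isRoot_target h.one_le le_rfl
  ext <;> simp [kpSig, mult_part hsource ht, mult_part htarget ht, (row_lt_of_mem_kpSlots hτ).ne]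

theorem kpE_kpF (h : Arrows n i s t) (a : Kp n) : kpE n i (kpF n i a) = some a := by
  rcases opening_prod_le_or_exists_firstOpening (kpSig n a) (kpSlots s t) (mult n s t a) with
    ha | ⟨σ, hσ⟩
  · rw [h.kpF_last ha, h.kpE_last (by rw [h.map_kpSig_add_part, h.mult_last_add_part]; omega),
      add_tsub_cancel_right]
  · obtain ⟨hsource, htarget⟩ := h.isRoot_of_mem_kpSlots hσ.mem
    rw [h.kpF_slot hσ, h.kpE_slot, move_move (part_le_of_mult_pos hsource hσ.opening_pos)]
    rw [h.mult_last_move (row_lt_of_mem_kpSlots hσ.mem) hsource htarget]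
    exact ((h.flip_move hσ.mem hσ.opening_pos).firstOpening_iff_lastClosing h.nodup_kpSlots).1 hσ

theorem kpF_of_kpE (h : Arrows n i s t) (ha : kpE n i a = some a') : kpF n i a' = a := by
  rcases opening_prod_lt_or_exists_lastClosing (kpSig n a) (kpSlots s t) (mult n s t a) with
    hlast | ⟨σ, hσ⟩ | hnone
  · obtain rfl := Option.some.inj ((h.kpE_last hlast).symm.trans ha)
    have hle : part n (root n s t) ≤ a :=
      part_le_of_mult_pos (h.isRoot_target h.one_le le_rfl) (Nat.zero_lt_of_lt hlast)
    obtain ⟨b, rfl⟩ := exists_add_of_le hle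
    rw [add_comm, h.map_kpSig_add_part, h.mult_last_add_part] at hlast
    rw [add_tsub_cancel_left, h.kpF_last (by omega), add_comm]
  · obtain rfl := Option.some.inj ((h.kpE_slot hσ).symm.trans ha)
    obtain ⟨hsource, htarget⟩ := h.isRoot_of_mem_kpSlots hσ.mem
    have hmove := move_move (w := root n σ.row σ.source)
      (part_le_of_mult_pos htarget hσ.closing_pos)
    have hpos : 0 < mult n σ.row σ.source
        (move n a (root n σ.row σ.target) (root n σ.row σ.source)) := by
      simp [mult_move a hsource htarget hsource]
    have hflip := h.flip_move hσ.mem hpos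
    rw [hmove] at hflip
    rw [h.kpF_slot (σ := σ), hmove]
    rw [h.mult_last_move (row_lt_of_mem_kpSlots hσ.mem) htarget hsource]
    exact (hflip.firstOpening_iff_lastClosing h.nodup_kpSlots).2 hσ
  · simp [h.kpE_none hnone] at ha

theorem kpEps_kpF (h : Arrows n i s t) (a : Kp n) :
    kpEps n i (kpF n i a) = kpEps n i a + 1 := by
  rw [h.kpEps_eq, h.kpEps_eq]
  norm_cast
  rcases opening_prod_le_or_exists_firstOpening (kpSig n a) (kpSlots s t) (mult n s t a) with
    ha | ⟨σ, hσ⟩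
  · rw [h.kpF_last ha, h.map_kpSig_add_part, h.mult_last_add_part, Bicyclic.smul_def,
      Bicyclic.smul_def]
    omega
  · obtain ⟨hsource, htarget⟩ := h.isRoot_of_mem_kpSlots hσ.mem
    rw [h.kpF_slot hσ, h.mult_last_move (row_lt_of_mem_kpSlots hσ.mem) hsource htarget]
    exact hσ.prod_smul_flip (h.flip_move hσ.mem hσ.opening_pos) h.nodup_kpSlots

theorem kpWt_kpF (h : Arrows n i s t) (a : Kp n) :
    kpWt n (kpF n i a) = kpWt n a - simpleRoot n i := by
  rcases opening_prod_le_or_exists_firstOpening (kpSig n a) (kpSlots s t) (mult n s t a) with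
    ha | ⟨σ, hσ⟩
  · rw [h.kpF_last ha, kpWt_add, kpWt_part (h.isRoot_target h.one_le le_rfl), h.simpleRoot_eq,
      sub_eq_add_neg]
  · obtain ⟨hsource, htarget⟩ := h.isRoot_of_mem_kpSlots hσ.mem
    rw [h.kpF_slot hσ, kpWt_move hsource htarget hσ.opening_pos, ← h.root_source_add hσ.mem]
    abel

end Arrows

/-! ### The crystal of Kostant partitions -/

section Pairing

variable {n i s k : ℕ} {t : Letter}

theorem pairing_eq_dotProduct (n i : ℕ) (w : Weight n) : pairing n i w = simpleRoot n i ⬝ᵥ w := rfl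

theorem ep_eq_single (hk : 1 ≤ k) (hkn : k ≤ n) : ep n k = Pi.single ⟨k - 1, by omega⟩ 1 := by
  funext m
  simp only [ep, Pi.single_apply, Fin.ext_iff]
  exact if_congr (by omega) rfl rfl

theorem pairing_sub (v w : Weight n) : pairing n i (v - w) = pairing n i v - pairing n i w :=
  dotProduct_sub _ _ _

theorem Arrows.pairing_simpleRoot (h : Arrows n i s t) : pairing n i (simpleRoot n i) = 2 := by
  have hs := h.one_le
  have hsign : t.sign * t.sign = 1 := by rcases t.sign_eq_one_or with e | e <;> simp [e]
  have hne : s - 1 ≠ s := by omega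
  rw [pairing_eq_dotProduct, h.simpleRoot_eq, root, weight_eq, h.idx_target,
    ep_eq_single hs h.lt.le, ep_eq_single (Nat.le_add_left 1 s) h.lt]
  simp [hne, hne.symm, hsign, -zsmul_eq_mul]

end Pairing

theorem kpCrystal_isCrystal {n : ℕ} (hn : 2 ≤ n) : (kpCrystal n).IsCrystal := by
  have hf (i : ℕ) (hi : 1 ≤ i) (hin : i ≤ n) (a : Kp n) :
      kpWt n (kpF n i a) = kpWt n a - simpleRoot n i ∧
        kpEps n i (kpF n i a) = kpEps n i a + 1 ∧
        kpEps n i (kpF n i a) + pairing n i (kpWt n (kpF n i a)) =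
          kpEps n i a + pairing n i (kpWt n a) - 1 := by
    obtain ⟨s, t, h⟩ := exists_arrows hn hi hin
    refine ⟨h.kpWt_kpF a, h.kpEps_kpF a, ?_⟩
    rw [h.kpWt_kpF, h.kpEps_kpF, pairing_sub, h.pairing_simpleRoot]
    ring
  have hfe (i : ℕ) (hi : 1 ≤ i) (hin : i ≤ n) (a a' : Kp n) :
      kpF n i a = a' ↔ kpE n i a' = some a := by
    obtain ⟨s, t, h⟩ := exists_arrows hn hi hin
    exact ⟨fun e => e ▸ h.kpE_kpF a, h.kpF_of_kpE⟩
  refine ⟨fun i _ _ a => rfl, fun i hi hin a a' e => ?_, fun i hi hin a a' e => ?_,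
    fun i hi hin a a' => ?_⟩
  · obtain ⟨hwt, heps, hphi⟩ := hf i hi hin a'
    rw [(hfe i hi hin a' a).2 e] at hwt heps hphi
    simp only [kpCrystal]
    exact ⟨by rw [hwt, sub_add_cancel], by omega, by omega⟩
  · exact Option.some.inj e ▸ hf i hi hin a
  · simpa only [kpCrystal, Option.some.injEq] using hfe i hi hin a a'

/-! ### The operators generate all Kostant partitions -/

/-- No bracket precedes those of the first nonzero row `k`, so a bracket `)` at the beginning of
row `k` is uncanceled. -/
theorem Arrows.exists_kpE {n i s k : ℕ} {t : Letter} (h : Arrows n i s t) {a : Kp n} (hk : 1 ≤ k)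
    (hks : k ≤ s) (hrows : ∀ j < k, ∀ z, IsRoot n j z → mult n j z a = 0)
    (hrow : mult n k t a ≠ 0 ∨ k < s ∧ mult n k (pos s) a = 0 ∧ mult n k (neg s) a ≠ 0) :
    ∃ a', kpE n i a = some a' := by
  rcases opening_prod_lt_or_exists_lastClosing (kpSig n a) (kpSlots s t) (mult n s t a) with
    hlast | ⟨σ, hσ⟩ | hnone
  · exact ⟨_, h.kpE_last hlast⟩
  · exact ⟨_, h.kpE_slot hσ⟩
  exfalso
  have trivial_slot (σ : Slot) (hσ : σ ∈ kpSlots s t) (hσk : σ.row < k) : kpSig n a σ = 1 := by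
    obtain ⟨hsource, htarget⟩ := h.isRoot_of_mem_kpSlots hσ
    ext <;> simp [kpSig, hrows σ.row hσk _ hsource, hrows σ.row hσk _ htarget]
  rcases hks.lt_or_eq with hks | rfl
  · obtain ⟨pre, post, hsplit⟩ := List.append_of_mem
      (show k ∈ List.range' 1 (s - 1) by rw [List.mem_range'_1]; omega)
    have hsorted : ∀ j ∈ pre, j < k := by
      have := List.pairwise_lt_range' (s := 1) (n := s - 1) (step := 1)
      rw [hsplit, List.pairwise_append] at this
      exact fun j hj => this.2.2 j hj k List.mem_cons_self
    have hpre : ((pre.flatMap fun j => [lowerSlot s t j, upperSlot s t j]).map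
        (kpSig n a)).prod = 1 := by
      refine List.prod_eq_one fun g hg => ?_
      obtain ⟨σ, hσ, rfl⟩ := List.mem_map.1 hg
      refine trivial_slot σ (by rw [kpSlots, hsplit, List.flatMap_append]; simp [hσ]) ?_
      simp only [List.mem_flatMap, List.mem_cons, List.not_mem_nil, or_false] at hσ
      obtain ⟨j, hj, rfl | rfl⟩ := hσ <;> exact hsorted j hj
    rw [kpSlots, hsplit, List.flatMap_append, List.map_append, List.prod_append, hpre, one_mul]
      at hnone
    simp only [List.flatMap_cons, List.cons_append, List.nil_append, List.map_cons,
      List.prod_cons, mul_smul] at hnone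
    generalize (List.prod (List.map (kpSig n a) (post.flatMap _))) • mult n s t a = y at hnone
    simp only [Bicyclic.smul_def, kpSig, lowerSlot, upperSlot] at hnone
    omega
  · have hone : ((kpSlots k t).map (kpSig n a)).prod = 1 := by
      refine List.prod_eq_one fun g hg => ?_
      obtain ⟨σ, hσ, rfl⟩ := List.mem_map.1 hg
      exact trivial_slot σ hσ (row_lt_of_mem_kpSlots hσ)
    rw [hone, one_smul] at hnone
    omega

theorem exists_kpE_of_ne_zero {n : ℕ} (hn : 2 ≤ n) {a : Kp n} (ha : a ≠ 0) :
    ∃ i a', 1 ≤ i ∧ i ≤ n ∧ kpE n i a = some a' := by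
  classical
  have hex : ∃ k z, IsRoot n k z ∧ mult n k z a ≠ 0 := by
    by_contra! hc
    exact ha (ext_mult fun j z hz => by rw [hc j z hz, map_zero])
  obtain ⟨z, ⟨hk, hkz, hzn⟩, hz⟩ := Nat.find_spec hex
  have hrows (j : ℕ) (hj : j < Nat.find hex) (x : Letter) (hx : IsRoot n j x) :
      mult n j x a = 0 := by
    by_contra hne
    exact Nat.find_min hex hj ⟨x, hx, hne⟩
  generalize Nat.find hex = k at *
  by_cases hpos : ∃ m, k < m ∧ m ≤ n ∧ mult n k (pos m) a ≠ 0
  · obtain ⟨m, hkm, hmn, hm⟩ := hpos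
    have h := arrows_of_lt (n := n) (i := m - 1) (by omega) (by omega)
    rw [Nat.sub_add_cancel (by omega)] at h
    obtain ⟨a', e⟩ := h.exists_kpE hk (by omega) hrows (Or.inl hm)
    exact ⟨m - 1, a', by omega, by omega, e⟩
  push Not at hpos
  cases z with
  | pos m => exact absurd (hpos m hkz hzn) hz
  | neg m =>
    simp only [idx_neg] at hkz hzn
    rcases hzn.lt_or_eq with hmn | rfl
    · obtain ⟨a', e⟩ := (arrows_of_lt (by omega) hmn).exists_kpE hk hkz.le hrows
        (Or.inr ⟨hkz, hpos m hkz hzn, hz⟩)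
      exact ⟨m, a', by omega, by omega, e⟩
    · obtain ⟨a', e⟩ := (arrows_self hn).exists_kpE hk (by omega) hrows (Or.inl hz)
      exact ⟨m, a', by omega, le_rfl, e⟩

section Height

variable {n : ℕ} {v : Weight n} {a : Kp n}

/-- The height of a weight: its pairing with `ρ^∨ = (n - 1, …, 1, 0)`, which is `1` on every
simple root. -/
def rootHeight (n : ℕ) : Weight n →ₗ[ℤ] ℤ :=
  Fintype.linearCombination ℤ fun m : Fin n => (n : ℤ) - 1 - m

theorem rootHeight_ep {k : ℕ} (hk : 1 ≤ k) (hkn : k ≤ n) : rootHeight n (ep n k) = n - k := by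
  rw [ep_eq_single hk hkn, rootHeight, Fintype.linearCombination_apply_single]
  simp [hk]

theorem rootHeight_pos (hv : v ∈ posRoots n) : 0 < rootHeight n v := by
  obtain ⟨j, z, ⟨hj, hjz, hzn⟩, rfl⟩ := mem_posRoots.1 hv
  rw [root, weight_eq, map_sub, map_smul, rootHeight_ep hj (by omega), rootHeight_ep (by omega) hzn]
  rcases z.sign_eq_one_or with e | e <;> rw [e, smul_eq_mul] <;> omega

theorem rootHeight_kpWt (a : Kp n) :
    rootHeight n (kpWt n a) = -∑ b, (a b : ℤ) * rootHeight n b.1 := by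
  rw [kpWt, map_neg, map_sum]
  simp_rw [map_nsmul, nsmul_eq_mul]

theorem rootHeight_kpWt_nonpos (a : Kp n) : rootHeight n (kpWt n a) ≤ 0 := by
  rw [rootHeight_kpWt, neg_nonpos]
  exact Finset.sum_nonneg fun b _ => mul_nonneg (by positivity) (rootHeight_pos b.2).le

theorem eq_zero_of_kpWt_eq_zero (h : kpWt n a = 0) : a = 0 := by
  have hsum := rootHeight_kpWt a
  rw [h, map_zero, zero_eq_neg, Finset.sum_eq_zero_iff_of_nonneg
    fun b _ => mul_nonneg (by positivity) (rootHeight_pos b.2).le] at hsum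
  funext b
  simpa [(rootHeight_pos b.2).ne'] using hsum b (Finset.mem_univ b)

end Height

theorem kp_induction {n : ℕ} (hn : 2 ≤ n) {p : Kp n → Prop} (zero : p 0)
    (step : ∀ i a, 1 ≤ i → i ≤ n → p a → p (kpF n i a)) (a : Kp n) : p a := by
  induction hm : (-rootHeight n (kpWt n a)).toNat using Nat.strong_induction_on generalizing a with
  | _ m ih =>
    rcases eq_or_ne a 0 with rfl | ha
    · exact zero
    obtain ⟨i, a', hi, hin, e⟩ := exists_kpE_of_ne_zero hn ha
    obtain ⟨s, t, h⟩ := exists_arrows hn hi hin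
    obtain rfl := h.kpF_of_kpE e
    refine step i a' hi hin (ih _ ?_ a' rfl)
    have hα : 0 < rootHeight n (simpleRoot n i) := by
      rw [h.simpleRoot_eq]
      exact rootHeight_pos (h.isRoot_target h.one_le le_rfl).mem_posRoots
    have := rootHeight_kpWt_nonpos a'
    rw [h.kpWt_kpF, map_sub] at hm
    omega

theorem crystalIso_unique {n : ℕ} (hn : 2 ≤ n) {B : Type} {C : CrystalData n B} {F G : B → Kp n}
    (hF : IsCrystalIso C (kpCrystal n) F) (hG : IsCrystalIso C (kpCrystal n) G) : F = G := by
  suffices ∀ a b, G b = a → F b = a from funext fun b => this _ b rfl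
  refine kp_induction hn (fun b hb => ?_) fun i a hi hin ih b hb => ?_
  · have hwt : kpWt n (F b) = kpWt n (G b) := (hF.wt_eq b).trans (hG.wt_eq b).symm
    exact eq_zero_of_kpWt_eq_zero (by rw [hwt, hb, ← kpWtHom_apply, map_zero])
  · obtain ⟨c, rfl⟩ := hG.bijective.2 a
    have hFc : some (kpF n i (F c)) = (C.f i c).map F := hF.f_eq i hi hin c
    have hGc : some (kpF n i (G c)) = (C.f i c).map G := hG.f_eq i hi hin c
    obtain ⟨b', hfc, hb'⟩ := Option.map_eq_some_iff.1 hGc.symm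
    obtain rfl := hG.bijective.1 (hb'.trans hb.symm)
    rw [hfc, ih c rfl] at hFc
    rw [← hb]
    simpa [hb'] using hFc.symm

/-! ### Rows of marginally large tableaux -/

namespace Letter

variable {n : ℕ} {x y : Letter}

theorem Le.antisymm (h : x.Le n y) (h' : y.Le n x) : x = y := by
  simp only [Letter.Le] at h h'
  grind

theorem eq_or_eq_bar_of_height_eq (hx : x.idx ≤ n) (hy : y.idx ≤ n)
    (h : x.height n = y.height n) : x = y ∨ x = y.bar ∧ y.idx = n := by
  cases x <;> cases y <;> grind [Letter.height, idx, bar]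

theorem pos_le_of_le_idx {j : ℕ} (hj : j < n) (hx : j ≤ x.idx) (hxn : x.idx ≤ n) :
    (pos j).Le n x := by
  cases x <;> grind [Letter.Le, Letter.height, idx]

end Letter

/-- The conditions on row `j` of a marginally large tableau that do not involve other rows. -/
structure IsRowAt (n j : ℕ) (r : List Letter) : Prop where
  sorted : r.Pairwise (Letter.Le n)
  le_idx : ∀ z ∈ r, j ≤ z.idx
  idx_le : ∀ z ∈ r, z.idx ≤ n

namespace IsRowAt

variable {n j : ℕ} {r l l' : List Letter} {x x' y z : Letter}

theorem cons (hr : IsRowAt n j r) (hj : j < n) : IsRowAt n j (pos j :: r) where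
  sorted := hr.sorted.cons fun z hz => pos_le_of_le_idx hj (hr.le_idx z hz) (hr.idx_le z hz)
  le_idx := List.forall_mem_cons.2 ⟨le_rfl, hr.le_idx⟩
  idx_le := List.forall_mem_cons.2 ⟨hj.le, hr.idx_le⟩

theorem tail (hr : IsRowAt n j r) : IsRowAt n j r.tail where
  sorted := hr.sorted.tail
  le_idx z hz := hr.le_idx z (List.mem_of_mem_tail hz)
  idx_le z hz := hr.idx_le z (List.mem_of_mem_tail hz)

theorem eq_cons_tail (hr : IsRowAt n j r) (hj : j < n) (hm : pos j ∈ r) :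
    r = pos j :: r.tail := by
  cases r with
  | nil => simp at hm
  | cons y r =>
    have hy : (pos j).Le n y :=
      pos_le_of_le_idx hj (hr.le_idx y List.mem_cons_self) (hr.idx_le y List.mem_cons_self)
    rcases List.mem_cons.1 hm with rfl | hm
    · rfl
    · rw [((List.pairwise_cons.1 hr.sorted).1 _ hm).antisymm hy, List.tail_cons]

theorem eq_of_height_eq (hr : IsRowAt n j r) (hx : x ∈ r) (hy : y ∈ r)
    (h : x.height n = y.height n) : x = y := by
  have : Std.Symm fun a b : Letter => a.height n = b.height n → a = b :=
    ⟨fun _ _ hab e => (hab e.symm).symm⟩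
  have hsep : r.Pairwise fun a b => a.height n = b.height n → a = b :=
    hr.sorted.imp fun hab e => hab.resolve_right (by omega)
  by_contra hne
  exact hne (hsep.forall hx hy hne h)

theorem eq_of_height_eq_of_bar (hr : IsRowAt n j r) (hx : x.idx ≤ n) (hy : y ∈ r)
    (hbar : x.idx = n → x.bar ∈ r → x ∈ r) (h : y.height n = x.height n) : y = x := by
  rcases eq_or_eq_bar_of_height_eq (hr.idx_le y hy) hx h with e | ⟨rfl, hxn⟩
  · exact e
  · exact hr.eq_of_height_eq hy (hbar hxn hy) h

theorem replace (hr : IsRowAt n j (l ++ x :: l')) (hjx : j ≤ x'.idx) (hxn : x'.idx ≤ n)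
    (hl : ∀ y ∈ l, y.Le n x') (hl' : ∀ y ∈ l', x'.Le n y) : IsRowAt n j (l ++ x' :: l') := by
  obtain ⟨hsl, hsl', hll'⟩ := List.pairwise_append.1 hr.sorted
  refine ⟨List.pairwise_append.2 ⟨hsl, hsl'.of_cons.cons hl', fun y hy => List.forall_mem_cons.2
    ⟨hl y hy, fun w hw => hll' y hy w (List.mem_cons_of_mem _ hw)⟩⟩, ?_, ?_⟩
  · have := hr.le_idx
    simp only [List.forall_mem_append, List.forall_mem_cons] at this ⊢
    exact ⟨this.1, hjx, this.2.2⟩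
  · have := hr.idx_le
    simp only [List.forall_mem_append, List.forall_mem_cons] at this ⊢
    exact ⟨this.1, hxn, this.2.2⟩

theorem raise (hr : IsRowAt n j (l ++ x :: l')) (hx : x ∉ l') (hjx : j ≤ x'.idx)
    (hxn : x'.idx ≤ n) (hxx' : x'.height n = x.height n + 1)
    (hbar : x'.idx = n → x'.bar ∈ l ++ x :: l' → x' ∈ l ++ x :: l') :
    IsRowAt n j (l ++ x' :: l') := by
  obtain ⟨-, hsl', hll'⟩ := List.pairwise_append.1 hr.sorted
  refine hr.replace hjx hxn (fun y hy => Or.inr ?_) fun y hy => ?_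
  · rcases hll' y hy x List.mem_cons_self with rfl | h <;> omega
  · have hlt : x.height n < y.height n :=
      ((List.pairwise_cons.1 hsl').1 y hy).resolve_left fun e => hx (e ▸ hy)
    rcases (hxx' ▸ hlt : x'.height n ≤ y.height n).lt_or_eq with h | h
    · exact Or.inr h
    · exact Or.inl (hr.eq_of_height_eq_of_bar hxn (by simp [hy]) hbar h.symm).symm

theorem lower (hr : IsRowAt n j (l ++ x :: l')) (hx : x ∉ l) (hjx : j ≤ x'.idx)
    (hxn : x'.idx ≤ n) (hxx' : x.height n = x'.height n + 1)
    (hbar : x'.idx = n → x'.bar ∈ l ++ x :: l' → x' ∈ l ++ x :: l') :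
    IsRowAt n j (l ++ x' :: l') := by
  obtain ⟨-, hsl', hll'⟩ := List.pairwise_append.1 hr.sorted
  refine hr.replace hjx hxn (fun y hy => ?_) fun y hy => Or.inr ?_
  · have hlt : y.height n < x.height n :=
      (hll' y hy x List.mem_cons_self).resolve_left fun e => hx (e ▸ hy)
    rcases (Nat.lt_succ_iff.1 (hlt.trans_eq hxx')).lt_or_eq with h | h
    · exact Or.inr h
    · exact Or.inl (hr.eq_of_height_eq_of_bar hxn (by simp [hy]) hbar h)
  · rcases (List.pairwise_cons.1 hsl').1 y hy with rfl | h <;> omega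

end IsRowAt

theorem IsMarginallyLarge.isRowAt {n : ℕ} {R : Filling} (hR : IsMarginallyLarge n R) (j : ℕ) :
    IsRowAt n j (R j) := by
  refine ⟨hR.weakly_increasing j, fun z hz => ?_, fun z hz => ?_⟩
  · have hj : 1 ≤ j ∧ j < n := by
      by_contra hj
      simp [hR.rows j hj] at hz
    obtain ⟨r, hr⟩ := List.head?_eq_some_iff.1 (hR.first_column j hj.1 hj.2)
    have hle : (pos j).Le n z := by
      rcases List.mem_cons.1 (hr ▸ hz) with rfl | hz
      · exact Or.inl rfl
      · exact (List.pairwise_cons.1 (hr ▸ hR.weakly_increasing j)).1 z hz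
    have hbd := hR.bounded j z hz
    cases z <;> grind [Letter.Le, Letter.height, idx]
  · have := hR.alphabet j z hz
    cases z <;> exact this.2

theorem isMarginallyLarge_iff {n : ℕ} {R : Filling} : IsMarginallyLarge n R ↔
    (∀ j, ¬ (1 ≤ j ∧ j < n) → R j = []) ∧ (∀ j, IsRowAt n j (R j)) ∧
      ∀ j, 1 ≤ j → j < n → (R j).count (pos j) = (R (j + 1)).length + 1 := by
  refine ⟨fun hR => ⟨hR.rows, hR.isRowAt, hR.marginal⟩, fun ⟨hnil, hrow, hmarg⟩ => ?_⟩
  have hmem (j : ℕ) (z : Letter) (hz : z ∈ R j) : 1 ≤ j ∧ j < n := by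
    by_contra hj
    simp [hnil j hj] at hz
  refine ⟨hnil, fun j z hz => ?_, fun j hj hjn => ?_, fun j => (hrow j).sorted, hmarg,
    fun j z hz => ?_, fun j h => ?_⟩
  · have := hmem j z hz
    have := (hrow j).le_idx z hz
    have := (hrow j).idx_le z hz
    cases z <;> grind [Letter.InAlphabet, idx]
  · have hm : pos j ∈ R j := List.count_pos_iff.1 (by rw [hmarg j hj hjn]; omega)
    rw [(hrow j).eq_cons_tail hjn hm, List.head?_cons]
  · have := hmem j z hz
    have := (hrow j).le_idx z hz
    have := (hrow j).idx_le z hz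
    cases z <;> grind [Letter.Le, Letter.height, idx]
  · have := (hrow j).eq_of_height_eq h.1 h.2 (by simp only [Letter.height]; omega)
    simp at this

theorem mlt_ext {n : ℕ} {T T' : MLT n}
    (h : ∀ j z, z ≠ pos j → (T.1 j).count z = (T'.1 j).count z) : T = T' := by
  refine Subtype.ext (funext fun j => ?_)
  by_cases hj : 1 ≤ j ∧ j < n
  swap
  · rw [T.2.rows j hj, T'.2.rows j hj]
  induction hm : n - j generalizing j with
  | zero => omega
  | succ m ih =>
    have hlen : (T.1 (j + 1)).length = (T'.1 (j + 1)).length := by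
      by_cases hjn : j + 1 < n
      · rw [ih (j + 1) (by omega) (by omega)]
      · rw [T.2.rows _ (by omega), T'.2.rows _ (by omega)]
    have hcount (z : Letter) : (T.1 j).count z = (T'.1 j).count z := by
      rcases eq_or_ne z (pos j) with rfl | hz
      · rw [T.2.marginal j hj.1 hj.2, T'.2.marginal j hj.1 hj.2, hlen]
      · exact h j z hz
    exact (List.perm_iff_count.2 hcount).eq_of_pairwise (fun _ _ _ _ => Letter.Le.antisymm)
      (T.2.weakly_increasing j) (T'.2.weakly_increasing j)

/-! ### Changing a letter and correcting the tableau -/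

/-- A filling that satisfies the conditions on a marginally large tableau, except possibly the one
on the number of letters `j` in row `j`. -/
structure IsMarginalExceptAt (n j : ℕ) (U : Filling) : Prop where
  rows : ∀ k, ¬ (1 ≤ k ∧ k < n) → U k = []
  isRowAt : ∀ k, IsRowAt n k (U k)
  marginal : ∀ k, k ≠ j → 1 ≤ k → k < n → (U k).count (pos k) = (U (k + 1)).length + 1

namespace IsMarginalExceptAt

variable {n i j k : ℕ} {U : Filling} {z : Letter}

theorem isMarginallyLarge_iff (hU : IsMarginalExceptAt n j U) (hj : 1 ≤ j) (hjn : j < n) :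
    IsMarginallyLarge n U ↔ (U j).count (pos j) = (U (j + 1)).length + 1 := by
  refine ⟨fun h => h.marginal j hj hjn, fun h => TypeD.isMarginallyLarge_iff.2
    ⟨hU.rows, hU.isRowAt, fun k hk hkn => ?_⟩⟩
  rcases eq_or_ne k j with rfl | hkj
  · exact h
  · exact hU.marginal k hkj hk hkn

theorem insertColumn (hU : IsMarginalExceptAt n j U) (hj : 1 ≤ j) (hjn : j < n)
    (hi : ∀ k, (1 ≤ k ∧ k ≤ i ∧ k < n) ↔ (1 ≤ k ∧ k ≤ j))
    (hc : (U j).count (pos j) = (U (j + 1)).length) :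
    IsMarginallyLarge n (insertColumn n i U) := by
  have happly (k : ℕ) : TypeD.insertColumn n i U k = if 1 ≤ k ∧ k ≤ j then pos k :: U k else U k :=
    if_congr (hi k) rfl rfl
  refine TypeD.isMarginallyLarge_iff.2 ⟨fun k hk => ?_, fun k => ?_, fun k hk hkn => ?_⟩
  · rw [happly, if_neg (by omega), hU.rows k hk]
  · rw [happly]
    split_ifs with hkj
    · exact (hU.isRowAt k).cons (by omega)
    · exact hU.isRowAt k
  · rw [happly, happly]
    rcases eq_or_ne k j with rfl | hkj
    · rw [if_pos ⟨hk, le_rfl⟩, if_neg (by omega), List.count_cons_self, hc]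
    · have hmarg := hU.marginal k hkj hk hkn
      split_ifs <;> simp only [List.count_cons_self, List.length_cons, hmarg] <;> omega

theorem eq_cons_tail (hU : IsMarginalExceptAt n j U) (hc : pos j ∈ U j) (hjn : j < n) (hk : 1 ≤ k)
    (hkj : k ≤ j) : U k = pos k :: (U k).tail := by
  refine (hU.isRowAt k).eq_cons_tail (by omega) ?_
  rcases eq_or_ne k j with rfl | hne
  · exact hc
  · exact List.count_pos_iff.1 (by rw [hU.marginal k hne hk (by omega)]; omega)

theorem deleteColumn (hU : IsMarginalExceptAt n j U) (hj : 1 ≤ j) (hjn : j < n)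
    (hi : ∀ k, (1 ≤ k ∧ k ≤ i ∧ k < n) ↔ (1 ≤ k ∧ k ≤ j))
    (hc : (U j).count (pos j) = (U (j + 1)).length + 2) :
    IsMarginallyLarge n (deleteColumn n i U) := by
  have happly (k : ℕ) : TypeD.deleteColumn n i U k = if 1 ≤ k ∧ k ≤ j then (U k).tail else U k :=
    if_congr (hi k) rfl rfl
  have hcons {k : ℕ} := hU.eq_cons_tail (k := k) (List.count_pos_iff.1 (by omega)) hjn
  have hcount {k : ℕ} (hk : 1 ≤ k) (hkj : k ≤ j) :
      (U k).count (pos k) = (U k).tail.count (pos k) + 1 := by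
    rw [hcons hk hkj, List.count_cons_self, List.tail_cons]
  refine TypeD.isMarginallyLarge_iff.2 ⟨fun k hk => ?_, fun k => ?_, fun k hk hkn => ?_⟩
  · rw [happly, if_neg (by omega), hU.rows k hk]
  · rw [happly]
    split_ifs with hkj
    · exact (hU.isRowAt k).tail
    · exact hU.isRowAt k
  · rw [happly, happly]
    rcases lt_trichotomy k j with hkj | rfl | hkj
    · have hlen := congrArg List.length (hcons (k := k + 1) (by omega) hkj)
      have hmarg := hU.marginal k hkj.ne hk hkn
      have := hcount hk hkj.le
      rw [List.length_cons] at hlen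
      rw [if_pos (by omega), if_pos (by omega)]
      omega
    · have := hcount hk le_rfl
      rw [if_pos (by omega), if_neg (by omega)]
      omega
    · rw [if_neg (by omega), if_neg (by omega), hU.marginal k hkj.ne' hk hkn]

theorem count_deleteColumn (hU : IsMarginalExceptAt n j U) (hjn : j < n) (hc : pos j ∈ U j)
    (hi : ∀ k, (1 ≤ k ∧ k ≤ i ∧ k < n) ↔ (1 ≤ k ∧ k ≤ j)) (hz : z ≠ pos k) :
    (TypeD.deleteColumn n i U k).count z = (U k).count z := by
  simp only [TypeD.deleteColumn, hi]
  split_ifs with hk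
  · rw [hU.eq_cons_tail hc hjn hk.1 hk.2, List.tail_cons, List.count_cons_of_ne hz.symm]
  · rfl

end IsMarginalExceptAt

theorem count_insertColumn {n i k : ℕ} {z : Letter} (U : Filling) (hz : z ≠ pos k) :
    (insertColumn n i U k).count z = (U k).count z := by
  simp only [insertColumn]
  split_ifs
  · rw [List.count_cons_of_ne hz.symm]
  · rfl

/-- `R'` arises from `R` by changing one letter `σ.source` in row `σ.row` to `σ.target`, up to the
placeholders `k` in the rows `k` (which are determined by the other letters). -/
def Step (σ : Slot) (R R' : Filling) : Prop :=
  ∀ k z, z ≠ pos k → (R' k).count z + (if k = σ.row ∧ z = σ.source then 1 else 0) =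
    (R k).count z + (if k = σ.row ∧ z = σ.target then 1 else 0)

theorem Step.mlt_ext {n : ℕ} {σ : Slot} {R : Filling} {T T' : MLT n} (h : Step σ R T.1)
    (h' : Step σ R T'.1) : T = T' :=
  TypeD.mlt_ext fun k z hz => by have := h k z hz; have := h' k z hz; omega

section Correction

variable {n i j : ℕ} {T : MLT n} {l l' : List Letter} {x x' : Letter}

theorem count_setBox {R : Filling} (hr : R j = l ++ x :: l') (x' : Letter) (k : ℕ) (z : Letter) :
    (setBox R j l.length x' k).count z + (if k = j ∧ z = x then 1 else 0) =
      (R k).count z + if k = j ∧ z = x' then 1 else 0 := by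
  rcases eq_or_ne k j with rfl | hk
  · simp only [setBox, Function.update_self, hr, List.set_append_right, List.count_append,
      List.count_cons, beq_iff_eq, true_and, eq_comm (a := z), le_refl, Nat.sub_self,
      List.set_cons_zero]
    omega
  · simp [setBox, hk]

theorem isMarginalExceptAt_setBox (hr : T.1 j = l ++ x :: l') (hj : 1 ≤ j) (hjn : j < n)
    (hrow : IsRowAt n j (l ++ x' :: l')) :
    IsMarginalExceptAt n j (setBox T.1 j l.length x') := by
  have hset : setBox T.1 j l.length x' j = l ++ x' :: l' := by simp [setBox, hr]
  have hne {k : ℕ} (hk : k ≠ j) : setBox T.1 j l.length x' k = T.1 k := by simp [setBox, hk]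
  refine ⟨fun k hk => ?_, fun k => ?_, fun k hkj hk hkn => ?_⟩
  · rw [hne (by omega), T.2.rows k hk]
  · rcases eq_or_ne k j with rfl | hkj
    · rwa [hset]
    · rw [hne hkj]
      exact T.2.isRowAt k
  · rw [hne hkj, T.2.marginal k hk hkn]
    rcases eq_or_ne (k + 1) j with rfl | hkj'
    · simp [setBox]
    · rw [hne hkj']

theorem exists_correct_insertColumn (hr : T.1 j = l ++ x :: l') (hj : 1 ≤ j) (hjn : j < n)
    (hrow : IsRowAt n j (l ++ x' :: l')) (hx' : x' ≠ pos j)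
    (hi : x = pos j → ∀ k, (1 ≤ k ∧ k ≤ i ∧ k < n) ↔ (1 ≤ k ∧ k ≤ j)) :
    ∃ T', correct n (setBox T.1 j l.length x') (insertColumn n i (setBox T.1 j l.length x')) =
      some T' ∧ Step ⟨j, x, x'⟩ T.1 T'.1 := by
  have hU := isMarginalExceptAt_setBox hr hj hjn hrow
  have hmarg := T.2.marginal j hj hjn
  have hcount := count_setBox hr x'
  have hcj := hcount j (pos j)
  have hlen : (setBox T.1 j l.length x' (j + 1)).length = (T.1 (j + 1)).length := by
    simp [setBox]
  simp only [true_and, if_neg hx'.symm] at hcj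
  by_cases hx : x = pos j
  · rw [if_pos hx.symm] at hcj
    refine ⟨⟨_, hU.insertColumn hj hjn (hi hx) (by omega)⟩, ?_, fun k z hz => ?_⟩
    · rw [correct, dif_neg (by rw [hU.isMarginallyLarge_iff hj hjn]; omega), dif_pos]
    · rw [count_insertColumn _ hz]
      exact hcount k z
  · rw [if_neg (Ne.symm hx)] at hcj
    have hML := (hU.isMarginallyLarge_iff hj hjn).2 (by omega)
    exact ⟨⟨_, hML⟩, by rw [correct, dif_pos hML], fun k z _ => hcount k z⟩

theorem exists_correct_deleteColumn (hr : T.1 j = l ++ x :: l') (hj : 1 ≤ j) (hjn : j < n)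
    (hrow : IsRowAt n j (l ++ x' :: l')) (hx : x ≠ pos j)
    (hi : x' = pos j → ∀ k, (1 ≤ k ∧ k ≤ i ∧ k < n) ↔ (1 ≤ k ∧ k ≤ j)) :
    ∃ T', correct n (setBox T.1 j l.length x') (deleteColumn n i (setBox T.1 j l.length x')) =
      some T' ∧ Step ⟨j, x', x⟩ T'.1 T.1 := by
  have hU := isMarginalExceptAt_setBox hr hj hjn hrow
  have hmarg := T.2.marginal j hj hjn
  have hcount := count_setBox hr x'
  have hcj := hcount j (pos j)
  have hlen : (setBox T.1 j l.length x' (j + 1)).length = (T.1 (j + 1)).length := by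
    simp [setBox]
  simp only [true_and, if_neg hx.symm] at hcj
  by_cases hx' : x' = pos j
  · rw [if_pos hx'.symm] at hcj
    refine ⟨⟨_, hU.deleteColumn hj hjn (hi hx') (by omega)⟩, ?_, fun k z hz => ?_⟩
    · rw [correct, dif_neg (by rw [hU.isMarginallyLarge_iff hj hjn]; omega), dif_pos]
    · rw [hU.count_deleteColumn hjn (List.count_pos_iff.1 (by omega)) (hi hx') hz]
      exact (hcount k z).symm
  · rw [if_neg (Ne.symm hx')] at hcj
    have hML := (hU.isMarginallyLarge_iff hj hjn).2 (by omega)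
    exact ⟨⟨_, hML⟩, by rw [correct, dif_pos hML], fun k z _ => (hcount k z).symm⟩

end Correction

/-! ### The brackets of a row -/

/-- The boxes of a row in the order of the reading word. -/
def rowBoxes (j : ℕ) (r : List Letter) : List (ℕ × ℕ × Letter) :=
  (r.zipIdx.map fun p => (j, p.2, p.1)).reverse

/-- The boxes of a row that contain the letter `z`, in the order of the reading word. -/
def letterBoxes (j : ℕ) (r : List Letter) (z : Letter) : List (ℕ × ℕ × Letter) :=
  (rowBoxes j r).filter fun b => b.2.2 = z

/-- The brackets of a filling in a slot. -/
def tabBlock (R : Filling) (σ : Slot) : List (Bracket × (ℕ × ℕ × Letter)) :=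
  block (letterBoxes σ.row (R σ.row) σ.target) (letterBoxes σ.row (R σ.row) σ.source)

/-- The brackets of row `j` of a filling. -/
def rowBlock (R : Filling) (s : ℕ) (t : Letter) (j : ℕ) : List (Bracket × (ℕ × ℕ × Letter)) :=
  tabBlock R (upperSlot s t j) ++ tabBlock R (lowerSlot s t j)

/-- The signature of `rowBlock R s t j`. -/
def rowSig (R : Filling) (s : ℕ) (t : Letter) (j : ℕ) : Bicyclic :=
  ⟨(R j).count (neg s) + ((R j).count t - (R j).count t.bar),
    ((R j).count t.bar - (R j).count t) + (R j).count (pos s)⟩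

section RowBrackets

variable {n i s j : ℕ} {t x : Letter} {r l l' : List Letter}

theorem rowBoxes_append_cons (j : ℕ) (l l' : List Letter) (x : Letter) :
    ∃ v v' : List (ℕ × ℕ × Letter), rowBoxes j (l ++ x :: l') = v ++ (j, l.length, x) :: v' ∧
      v.map (fun b => b.2.2) = l'.reverse ∧ v'.map (fun b => b.2.2) = l.reverse := by
  refine ⟨((l'.zipIdx (l.length + 1)).map fun p => (j, p.2, p.1)).reverse, rowBoxes j l, ?_, ?_, ?_⟩
  · simp [rowBoxes, List.zipIdx_append, List.zipIdx_cons]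
  · simp [Function.comp_def]
  · simp [rowBoxes, Function.comp_def]

theorem map_letter_rowBoxes (j : ℕ) (r : List Letter) :
    (rowBoxes j r).map (fun b => b.2.2) = r.reverse := by
  simp [rowBoxes, Function.comp_def]

theorem length_letterBoxes (j : ℕ) (r : List Letter) (z : Letter) :
    (letterBoxes j r z).length = r.count z := by
  rw [← List.count_reverse, ← map_letter_rowBoxes j r, List.count, List.countP_map, letterBoxes,
    ← List.countP_eq_length_filter]
  rfl

theorem signature_tabBlock (R : Filling) (σ : Slot) :
    signature (tabBlock R σ) = ⟨(R σ.row).count σ.target, (R σ.row).count σ.source⟩ := by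
  simp only [tabBlock, signature_block, length_letterBoxes]

theorem signature_rowBlock (R : Filling) (s : ℕ) (t : Letter) (j : ℕ) :
    signature (rowBlock R s t j) = rowSig R s t j := by
  simp only [rowBlock, signature_append, signature_tabBlock]
  rfl

theorem filter_letter_eq_nil {v : List (ℕ × ℕ × Letter)}
    (hx : x ∉ v.map fun b => b.2.2) : v.filter (fun b => b.2.2 = x) = [] := by
  rw [List.filter_eq_nil_iff]
  intro b hb
  rw [decide_eq_true_iff]
  exact fun e => hx (List.mem_map.2 ⟨b, hb, e⟩)

theorem filter_letter_eq_nil_of_height_le {v : List (ℕ × ℕ × Letter)} {z : Letter}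
    (hv : ∀ b ∈ v, b.2.2.Le n z) (hne : x ≠ z) (hx : z.height n ≤ x.height n) :
    v.filter (fun b => b.2.2 = x) = [] := by
  refine filter_letter_eq_nil fun hm => ?_
  obtain ⟨b, hb, rfl⟩ := List.mem_map.1 hm
  rcases hv b hb with e | hlt
  · exact hne e
  · exact hx.not_gt hlt

theorem exists_head?_letterBoxes (j : ℕ) (hx : x ∈ r) :
    ∃ l l', r = l ++ x :: l' ∧ x ∉ l' ∧ (letterBoxes j r x).head? = some (j, l.length, x) := by
  obtain ⟨u, w, hr, hu⟩ := List.eq_append_cons_of_mem (List.mem_reverse.2 hx)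
  obtain rfl : r = w.reverse ++ x :: u.reverse := by
    rw [← List.reverse_reverse r, hr]
    simp
  refine ⟨_, _, rfl, by simpa using hu, ?_⟩
  obtain ⟨v, v', hv, hu', -⟩ := rowBoxes_append_cons j w.reverse u.reverse x
  rw [letterBoxes, hv, List.filter_append, filter_letter_eq_nil (by simpa [hu'] using hu),
    List.nil_append, List.filter_cons_of_pos (by simp), List.head?_cons]

theorem exists_getLast?_letterBoxes (j : ℕ) (hx : x ∈ r) :
    ∃ l l', r = l ++ x :: l' ∧ x ∉ l ∧
      (letterBoxes j r x).getLast? = some (j, l.length, x) := by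
  obtain ⟨l, l', rfl, hl⟩ := List.eq_append_cons_of_mem hx
  refine ⟨l, l', rfl, hl, ?_⟩
  obtain ⟨v, v', hv, -, hl'⟩ := rowBoxes_append_cons j l l' x
  rw [letterBoxes, hv, List.filter_append, List.filter_cons_of_pos (by simp),
    filter_letter_eq_nil (v := v') (by rwa [hl', List.mem_reverse]), List.getLast?_append_cons,
    List.getLast?_singleton]

namespace Arrows

theorem height_target (h : Arrows n i s t) : t.height n = s + 1 := by
  rcases h.target_eq with rfl | ⟨e, rfl⟩ <;> simp only [Letter.height]
  omega

theorem height_bar_target (h : Arrows n i s t) : t.bar.height n + (s + 1) = 2 * n := by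
  have := h.lt
  rcases h.target_eq with rfl | ⟨e, rfl⟩ <;> simp only [bar_pos, bar_neg, Letter.height] <;> omega

theorem target_ne (h : Arrows n i s t) :
    t ≠ pos s ∧ t ≠ neg s ∧ t.bar ≠ pos s ∧ t.bar ≠ neg s ∧ t.bar ≠ t := by
  have ht := h.idx_target
  refine ⟨?_, ?_, ?_, ?_, t.bar_ne_self⟩ <;> intro e <;> simpa [ht] using congrArg Letter.idx e

theorem filterMap_eq_block_append_block (h : Arrows n i s t) {v : List (ℕ × ℕ × Letter)}
    (hv : v.Pairwise fun a b => b.2.2.Le n a.2.2) :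
    v.filterMap (fun b =>
      if (b.2.2.prev n i).isSome then some (Bracket.closing, b)
      else if (b.2.2.next n i).isSome then some (Bracket.opening, b)
      else none) =
    block (v.filter fun b => b.2.2 = neg s) (v.filter fun b => b.2.2 = t.bar) ++
      block (v.filter fun b => b.2.2 = t) (v.filter fun b => b.2.2 = pos s) := by
  obtain ⟨h₁, h₂, h₃, h₄, h₅⟩ := h.target_ne
  have hs := h.lt
  have ht := h.height_target
  have ht' := h.height_bar_target
  induction v with
  | nil => rfl
  | cons b v ih =>
    obtain ⟨hb, hv'⟩ := List.pairwise_cons.1 hv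
    obtain ⟨j, c, z⟩ := b
    have hnil {x : Letter} := filter_letter_eq_nil_of_height_le (x := x) (z := z) hb
    rw [List.filterMap_cons, ih hv']
    simp only [h.prev_eq, h.next_eq, List.filter_cons, decide_eq_true_iff]
    have hneg : (neg s).height n + s = 2 * n := by simp only [Letter.height]; omega
    have hpos : (pos s).height n = s := rfl
    by_cases e₁ : z = neg s
    · subst e₁
      simp [h₂.symm, h₄.symm, block]
    by_cases e₂ : z = t.bar
    · subst e₂
      simp [h₃, h₄, h₅, block, hnil (x := neg s) h₄.symm (by omega)]
    by_cases e₃ : z = t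
    · subst e₃
      simp [h₁, h₂, h₅.symm, block, hnil (x := neg s) h₂.symm (by omega),
        hnil (x := z.bar) h₅ (by omega)]
    by_cases e₄ : z = pos s
    · subst e₄
      simp [h₁.symm, h₃.symm, block, hnil (x := neg s) (by simp) (by omega),
        hnil (x := t.bar) h₃ (by omega), hnil (x := t) h₁ (by omega)]
    simp [e₁, e₂, e₃, e₄]

theorem filterMap_rowBoxes (h : Arrows n i s t) (R : Filling) (hr : (R j).Pairwise (Letter.Le n)) :
    (rowBoxes j (R j)).filterMap (fun b =>
      if (b.2.2.prev n i).isSome then some (Bracket.closing, b)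
      else if (b.2.2.next n i).isSome then some (Bracket.opening, b)
      else none) = rowBlock R s t j := by
  refine h.filterMap_eq_block_append_block ?_
  rw [← List.pairwise_map (f := fun b : ℕ × ℕ × Letter => b.2.2) (R := fun x y => y.Le n x),
    map_letter_rowBoxes, List.pairwise_reverse]
  exact hr

end Arrows

end RowBrackets

section Rows

variable {n i s : ℕ} {t : Letter}

theorem rowSig_succ_closing_le (s : ℕ) (t : Letter) (T : MLT n) :
    (rowSig T.1 s t (s + 1)).closing ≤ (T.1 (s + 1)).length := by
  have hzero : (T.1 (s + 1)).count (neg s) = 0 :=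
    List.count_eq_zero.2 fun hx => (T.2.isRowAt _).le_idx _ hx |>.not_gt (Nat.lt_succ_self s)
  have := List.count_le_length (a := t) (l := T.1 (s + 1))
  simp only [rowSig, hzero]
  omega

namespace Arrows

theorem brackets_eq_flatMap (h : Arrows n i s t) (T : MLT n) :
    brackets n i T.1 = (List.range' 1 (n - 1)).flatMap (rowBlock T.1 s t) := by
  rw [brackets, boxes, List.filterMap_flatMap]
  exact List.flatMap_congr fun j _ => h.filterMap_rowBoxes T.1 (T.2.weakly_increasing j)

theorem rowSig_eq_one (h : Arrows n i s t) (T : MLT n) {k : ℕ} (hk : s + 1 < k) :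
    rowSig T.1 s t k = 1 := by
  have hzero {x : Letter} (hx : x.idx ≤ s + 1) : (T.1 k).count x = 0 :=
    List.count_eq_zero.2 fun hx' => ((T.2.isRowAt k).le_idx x hx').not_gt (hx.trans_lt hk)
  have ht := h.idx_target
  ext <;> simp [rowSig, hzero (x := pos s) (Nat.le_succ s), hzero (x := neg s) (Nat.le_succ s),
    hzero ht.le, hzero (t.idx_bar.trans ht).le]

theorem exists_brackets_eq (h : Arrows n i s t) (T : MLT n) :
    ∃ Y, brackets n i T.1 = (List.range' 1 (s - 1)).flatMap (rowBlock T.1 s t) ++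
      (rowBlock T.1 s t s ++ Y) ∧ (signature Y).closing < (T.1 s).count (pos s) := by
  have hs := h.one_le
  have hsn := h.lt
  have hrange : List.range' 1 (n - 1) =
      List.range' 1 (s - 1) ++ s :: List.range' (s + 1) (n - 1 - s) := by
    rw [← List.range'_succ, show n - 1 = (s - 1) + (n - 1 - s + 1) by omega,
      ← List.range'_append_1]
    congr 2 <;> omega
  refine ⟨(List.range' (s + 1) (n - 1 - s)).flatMap (rowBlock T.1 s t), ?_, ?_⟩
  · rw [h.brackets_eq_flatMap, hrange, List.flatMap_append, List.flatMap_cons]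
  · have hmarg := T.2.marginal s hs hsn
    simp only [signature_flatMap, signature_rowBlock]
    rcases n - 1 - s with _ | m
    · simp [hmarg]
    have htail : ((List.range' (s + 1 + 1) m).map (rowSig T.1 s t)).prod = 1 := by
      refine List.prod_eq_one fun p hp => ?_
      obtain ⟨k, hk, rfl⟩ := List.mem_map.1 hp
      exact h.rowSig_eq_one T (List.mem_range'_1.1 hk).1
    have := rowSig_succ_closing_le s t T
    rw [List.range'_succ, List.map_cons, List.prod_cons, htail, mul_one]
    omega

end Arrows

end Rows

/-! ### The operators on tableaux -/

namespace Arrows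

variable {n i s : ℕ} {t : Letter} {σ : Slot} {T : MLT n}

theorem next_source (h : Arrows n i s t) (hσ : IsSlot s t σ) :
    σ.source.next n i = some σ.target := by
  obtain ⟨-, -, h₁, -⟩ := h.target_ne
  rcases hσ with ⟨-, -, e | e⟩ <;> rw [e] <;> simp [lowerSlot, upperSlot, h.next_eq, h₁]

theorem prev_target (h : Arrows n i s t) (hσ : IsSlot s t σ) :
    σ.target.prev n i = some σ.source := by
  obtain ⟨-, h₁, -⟩ := h.target_ne
  rcases hσ with ⟨-, -, e | e⟩ <;> rw [e] <;> simp [lowerSlot, upperSlot, h.prev_eq, h₁.symm]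

theorem height_slot (h : Arrows n i s t) (hσ : IsSlot s t σ) :
    σ.target.height n = σ.source.height n + 1 := by
  have := h.lt
  have ht := h.height_target
  have ht' := h.height_bar_target
  rcases hσ with ⟨-, -, e | e⟩ <;> rw [e] <;>
    simp only [lowerSlot, upperSlot, show (pos s).height n = s from rfl,
      show (neg s).height n = 2 * n - s from rfl] <;> omega

theorem idx_source_mem (h : Arrows n i s t) (hσ : IsSlot s t σ) :
    σ.row ≤ σ.source.idx ∧ σ.source.idx ≤ n := by
  have := h.lt
  have ht := h.idx_target
  rcases hσ with ⟨-, hj, e | e⟩ <;> rw [e] <;>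
    simp only [lowerSlot, upperSlot, idx_pos, idx_bar, ht] <;> omega

theorem idx_target_mem (h : Arrows n i s t) (hσ : IsSlot s t σ) :
    σ.row ≤ σ.target.idx ∧ σ.target.idx ≤ n := by
  have := h.lt
  have ht := h.idx_target
  rcases hσ with ⟨-, hj, e | e⟩ <;> rw [e] <;>
    simp only [lowerSlot, upperSlot, idx_neg, ht] <;> omega

theorem target_ne_pos_row (h : Arrows n i s t) (hσ : IsSlot s t σ) : σ.target ≠ pos σ.row := by
  have ht := h.idx_target
  rcases hσ with ⟨-, hj, e | e⟩ <;> rw [e] <;> intro e' <;> have := congrArg Letter.idx e'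
  · simp only [lowerSlot, ht, idx_pos] at this
    omega
  · simp [upperSlot] at e'

theorem eq_lowerSlot_of_source_eq_pos_row (h : Arrows n i s t) (hσ : IsSlot s t σ)
    (he : σ.source = pos σ.row) : σ = lowerSlot s t s := by
  have ht := h.idx_target
  obtain ⟨-, hj, e⟩ := hσ
  have := congrArg Letter.idx he
  rcases e with e | e <;> rw [e] at this he ⊢
  · simp only [lowerSlot, idx_pos] at this ⊢
    rw [this]
  · simp only [upperSlot, idx_bar, ht, idx_pos] at this
    omega

theorem exists_tabF_of_head? (h : Arrows n i s t) (hσ : IsSlot s t σ)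
    (hpos : 0 < (T.1 σ.row).count σ.source)
    (harrow : σ = upperSlot s t σ.row ∨
      σ = lowerSlot s t σ.row ∧ (T.1 σ.row).count t.bar ≤ (T.1 σ.row).count t)
    (hhead : (uncanceled (brackets n i T.1)).2.head? = (uncanceled (tabBlock T.1 σ)).2.head?) :
    ∃ T', tabF n i T = some T' ∧ Step σ T.1 T'.1 := by
  have hσn := hσ.2.1.trans_lt h.lt
  have hrow := T.2.isRowAt σ.row
  obtain ⟨l, l', hr, hl', hbox⟩ := exists_head?_letterBoxes σ.row (List.count_pos_iff.1 hpos)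
  have hbar (hn : σ.target.idx = n) (hm : σ.target.bar ∈ T.1 σ.row) : σ.target ∈ T.1 σ.row := by
    rcases harrow with e | ⟨e, hle⟩ <;> rw [e] at hn hm ⊢
    · exact absurd hn h.lt.ne
    · exact List.count_pos_iff.1 ((List.count_pos_iff.2 hm).trans_le hle)
  rw [tabF, hhead, tabBlock, uncanceled_block, hbox]
  simp only [Option.bind_some, h.next_source hσ]
  rw [hr] at hrow hbar
  refine exists_correct_insertColumn hr hσ.1 hσn (hrow.raise hl' (h.idx_target_mem hσ).1
    (h.idx_target_mem hσ).2 (h.height_slot hσ) hbar) (h.target_ne_pos_row hσ) fun he => ?_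
  rw [h.eq_lowerSlot_of_source_eq_pos_row hσ he]
  exact h.column_iff

theorem exists_tabE_of_getLast? (h : Arrows n i s t) (hσ : IsSlot s t σ)
    (hpos : 0 < (T.1 σ.row).count σ.target)
    (harrow : σ = upperSlot s t σ.row ∧ (T.1 σ.row).count t ≤ (T.1 σ.row).count t.bar ∨
      σ = lowerSlot s t σ.row)
    (hlast : (uncanceled (brackets n i T.1)).1.getLast? =
      (uncanceled (tabBlock T.1 σ)).1.getLast?) :
    ∃ T', tabE n i T = some T' ∧ Step σ T'.1 T.1 := by
  have hσn := hσ.2.1.trans_lt h.lt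
  have hrow := T.2.isRowAt σ.row
  obtain ⟨l, l', hr, hl, hbox⟩ := exists_getLast?_letterBoxes σ.row (List.count_pos_iff.1 hpos)
  have hbar (hn : σ.source.idx = n) (hm : σ.source.bar ∈ T.1 σ.row) : σ.source ∈ T.1 σ.row := by
    rcases harrow with ⟨e, hle⟩ | e <;> rw [e] at hn hm ⊢
    · rw [upperSlot, bar_bar] at hm
      exact List.count_pos_iff.1 ((List.count_pos_iff.2 hm).trans_le hle)
    · exact absurd hn h.lt.ne
  rw [tabE, hlast, tabBlock, uncanceled_block, hbox]
  simp only [Option.bind_some, h.prev_target hσ]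
  rw [hr] at hrow hbar
  refine exists_correct_deleteColumn hr hσ.1 hσn (hrow.lower hl (h.idx_source_mem hσ).1
    (h.idx_source_mem hσ).2 (h.height_slot hσ) hbar) (h.target_ne_pos_row hσ) fun he => ?_
  rw [h.eq_lowerSlot_of_source_eq_pos_row hσ he]
  exact h.column_iff

end Arrows

/-- `σ` is the slot in which `f_i` acts on the tableau `R`: the operator acts in the first row
before row `s` that allows it, or else in row `s`. -/
structure IsFSlot (s : ℕ) (t : Letter) (R : Filling) (σ : Slot) : Prop where
  isSlot : IsSlot s t σ
  row : FirstOpening (rowSig R s t) (List.range' 1 (s - 1)) (rowSig R s t s).closing σ.row ∨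
    σ.row = s ∧
      ((List.range' 1 (s - 1)).map (rowSig R s t)).prod.opening ≤ (rowSig R s t s).closing
  arrow : σ = upperSlot s t σ.row ∧ (R σ.row).count t < (R σ.row).count t.bar ∨
    σ = lowerSlot s t σ.row ∧ (R σ.row).count t.bar ≤ (R σ.row).count t

/-- `σ` is the slot in which `e_i` acts on the tableau `R`. -/
structure IsESlot (s : ℕ) (t : Letter) (R : Filling) (σ : Slot) : Prop where
  isSlot : IsSlot s t σ
  row : LastClosing (rowSig R s t) (List.range' 1 (s - 1)) (rowSig R s t s).closing σ.row ∨
    σ.row = s ∧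
      ((List.range' 1 (s - 1)).map (rowSig R s t)).prod.opening < (rowSig R s t s).closing
  arrow : σ = upperSlot s t σ.row ∧ (R σ.row).count t ≤ (R σ.row).count t.bar ∨
    σ = lowerSlot s t σ.row ∧ (R σ.row).count t.bar < (R σ.row).count t

section Rows

variable {n s i : ℕ} {t : Letter} {R R' : Filling} {σ : Slot} {T T' : MLT n}

theorem exists_isFSlot (hs : 1 ≤ s) (t : Letter) (R : Filling) : ∃ σ, IsFSlot s t R σ := by
  obtain ⟨j, hj, hjs, hrow⟩ : ∃ j, 1 ≤ j ∧ j ≤ s ∧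
      (FirstOpening (rowSig R s t) (List.range' 1 (s - 1)) (rowSig R s t s).closing j ∨ j = s ∧
        ((List.range' 1 (s - 1)).map (rowSig R s t)).prod.opening ≤ (rowSig R s t s).closing) := by
    rcases opening_prod_le_or_exists_firstOpening (rowSig R s t) (List.range' 1 (s - 1))
      (rowSig R s t s).closing with h | ⟨j, hj⟩
    · exact ⟨s, hs, le_rfl, Or.inr ⟨rfl, h⟩⟩
    · have := List.mem_range'_1.1 hj.mem
      exact ⟨j, this.1, by omega, Or.inl hj⟩
  rcases lt_or_ge ((R j).count t) ((R j).count t.bar) with h | h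
  · exact ⟨upperSlot s t j, ⟨hj, hjs, Or.inr rfl⟩, hrow, Or.inl ⟨rfl, h⟩⟩
  · exact ⟨lowerSlot s t j, ⟨hj, hjs, Or.inl rfl⟩, hrow, Or.inr ⟨rfl, h⟩⟩

theorem exists_isESlot (hs : 1 ≤ s) (hR : ((List.range' 1 (s - 1)).map (rowSig R s t)).prod •
    (rowSig R s t s).closing ≠ 0) : ∃ σ, IsESlot s t R σ := by
  obtain ⟨j, hj, hjs, hrow⟩ : ∃ j, 1 ≤ j ∧ j ≤ s ∧
      (LastClosing (rowSig R s t) (List.range' 1 (s - 1)) (rowSig R s t s).closing j ∨ j = s ∧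
        ((List.range' 1 (s - 1)).map (rowSig R s t)).prod.opening < (rowSig R s t s).closing) := by
    rcases opening_prod_lt_or_exists_lastClosing (rowSig R s t) (List.range' 1 (s - 1))
      (rowSig R s t s).closing with h | ⟨j, hj⟩ | h
    · exact ⟨s, hs, le_rfl, Or.inr ⟨rfl, h⟩⟩
    · have := List.mem_range'_1.1 hj.mem
      exact ⟨j, this.1, by omega, Or.inl hj⟩
    · exact absurd h hR
  rcases lt_or_ge ((R j).count t.bar) ((R j).count t) with h | h
  · exact ⟨lowerSlot s t j, ⟨hj, hjs, Or.inl rfl⟩, hrow, Or.inr ⟨rfl, h⟩⟩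
  · exact ⟨upperSlot s t j, ⟨hj, hjs, Or.inr rfl⟩, hrow, Or.inl ⟨rfl, h⟩⟩

theorem signature_tabBlock_upperSlot (R : Filling) (s : ℕ) (t : Letter) (j : ℕ) :
    signature (tabBlock R (upperSlot s t j)) = ⟨(R j).count (neg s), (R j).count t.bar⟩ :=
  signature_tabBlock R _

theorem signature_tabBlock_lowerSlot (R : Filling) (s : ℕ) (t : Letter) (j : ℕ) :
    signature (tabBlock R (lowerSlot s t j)) = ⟨(R j).count t, (R j).count (pos s)⟩ :=
  signature_tabBlock R _

theorem IsFSlot.source_pos (hσ : IsFSlot s t R σ) (hR : 0 < (R s).count (pos s)) :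
    0 < (R σ.row).count σ.source := by
  have hrow : 0 < (rowSig R s t σ.row).opening := by
    rcases hσ.row with h | ⟨h, -⟩
    · exact h.opening_pos
    · rw [h]
      exact Nat.lt_add_left _ hR
  rw [rowSig] at hrow
  rcases hσ.arrow with ⟨e, h⟩ | ⟨e, h⟩ <;> rw [e] at h hrow ⊢ <;>
    simp only [upperSlot, lowerSlot] at h hrow ⊢ <;> omega

theorem IsESlot.target_pos (hσ : IsESlot s t R σ) : 0 < (R σ.row).count σ.target := by
  have hrow : 0 < (rowSig R s t σ.row).closing := by
    rcases hσ.row with h | ⟨h, h'⟩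
    · exact h.closing_pos
    · rw [h]
      exact Nat.zero_lt_of_lt h'
  rw [rowSig] at hrow
  rcases hσ.arrow with ⟨e, h⟩ | ⟨e, h⟩ <;> rw [e] at h hrow ⊢ <;>
    simp only [upperSlot, lowerSlot] at h hrow ⊢ <;> omega

section Labels

variable {Y : List (Bracket × (ℕ × ℕ × Letter))}

theorem signature_rowBlock_append (hY : (signature Y).closing < (R s).count (pos s)) :
    (signature (rowBlock R s t s ++ Y)).closing = (rowSig R s t s).closing := by
  simp only [signature_append, signature_rowBlock, Bicyclic.mul_closing, rowSig]
  omega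

theorem IsFSlot.head?_uncanceled (hσ : IsFSlot s t R σ)
    (hY : (signature Y).closing < (R s).count (pos s)) :
    (uncanceled ((List.range' 1 (s - 1)).flatMap (rowBlock R s t) ++
      (rowBlock R s t s ++ Y))).2.head? = (uncanceled (tabBlock R σ)).2.head? := by
  have hpos := hσ.source_pos (Nat.zero_lt_of_lt hY)
  trans (uncanceled (rowBlock R s t σ.row)).2.head?
  · rcases hσ.row with h | ⟨h, h'⟩
    · exact h.head?_uncanceled (fun j _ => signature_rowBlock R s t j)
        (signature_rowBlock_append hY)
    · rw [h]
      refine head?_uncanceled_append_append ?_ ?_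
      · simpa only [signature_flatMap, signature_rowBlock] using h'
      · rw [signature_rowBlock]
        exact Nat.lt_add_left _ hY
  · rcases hσ.arrow with ⟨e, h⟩ | ⟨e, h⟩ <;> generalize σ.row = j at * <;> subst e
    · refine head?_uncanceled_append_append (X := []) (Nat.zero_le _) ?_
      simpa only [signature_tabBlock_upperSlot, signature_tabBlock_lowerSlot] using h
    · have := head?_uncanceled_append_append (X := tabBlock R (upperSlot s t j))
        (l := tabBlock R (lowerSlot s t j)) (Z := [])
      simp only [signature_tabBlock_upperSlot, signature_tabBlock_lowerSlot,
        List.append_nil] at this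
      exact this h hpos

theorem IsESlot.getLast?_uncanceled (hσ : IsESlot s t R σ)
    (hY : (signature Y).closing < (R s).count (pos s)) :
    (uncanceled ((List.range' 1 (s - 1)).flatMap (rowBlock R s t) ++
      (rowBlock R s t s ++ Y))).1.getLast? = (uncanceled (tabBlock R σ)).1.getLast? := by
  have hpos := hσ.target_pos
  trans (uncanceled (rowBlock R s t σ.row)).1.getLast?
  · rcases hσ.row with h | ⟨h, h'⟩
    · exact h.getLast?_uncanceled (fun j _ => signature_rowBlock R s t j)
        (signature_rowBlock_append hY)
    · rw [h]
      refine getLast?_uncanceled_append_append ?_ ?_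
      · simpa only [signature_flatMap, signature_rowBlock] using h'
      · rw [signature_rowBlock]
        exact hY.le.trans (Nat.le_add_left _ _)
  · rcases hσ.arrow with ⟨e, h⟩ | ⟨e, h⟩ <;> generalize σ.row = j at * <;> subst e
    · refine getLast?_uncanceled_append_append (X := []) ?_ ?_
      · rw [signature_tabBlock_upperSlot]
        exact hpos
      · simpa only [signature_tabBlock_upperSlot, signature_tabBlock_lowerSlot] using h
    · have := getLast?_uncanceled_append_append (X := tabBlock R (upperSlot s t j))
        (l := tabBlock R (lowerSlot s t j)) (Z := [])
      simp only [signature_tabBlock_upperSlot, signature_tabBlock_lowerSlot,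
        List.append_nil] at this
      exact this h (Nat.zero_le _)

end Labels

namespace Step

theorem rowSig_of_ne (h : Step σ R R') {k : ℕ} (hks : k < s) (hts : s < t.idx) (hk : k ≠ σ.row) :
    rowSig R s t k = rowSig R' s t k := by
  have hcount {z : Letter} (hz : k < z.idx) : (R' k).count z = (R k).count z := by
    simpa [hk] using h k z (by rintro rfl; exact hz.false)
  have hkt := hks.trans hts
  simp only [rowSig, hcount (z := pos s) hks, hcount (z := neg s) hks, hcount hkt,
    hcount (hkt.trans_eq t.idx_bar.symm)]

theorem rowSig_closing_of_ne (h : Step σ R R') (ht : t.idx = s + 1) (hs : s ≠ σ.row) :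
    (rowSig R s t s).closing = (rowSig R' s t s).closing := by
  have hcount {z : Letter} (hz : z ≠ pos s) : (R' s).count z = (R s).count z := by
    simpa [hs] using h s z hz
  have hne {z : Letter} (hz : z.idx = s + 1) : z ≠ pos s := fun e => by simp [e] at hz
  simp only [rowSig, hcount (z := neg s) (by simp), hcount (hne ht),
    hcount (hne (t.idx_bar.trans ht))]

variable {j : ℕ}

theorem count_of_upperSlot (h : Step (upperSlot s t j) R R') (ht : t.idx = s + 1) (hjs : j ≤ s) :
    (R' j).count (neg s) = (R j).count (neg s) + 1 ∧ (R' j).count t.bar + 1 = (R j).count t.bar ∧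
      (R' j).count t = (R j).count t ∧
      (j < s → (R' j).count (pos s) = (R j).count (pos s)) := by
  have hne {z z' : Letter} (hz : z.idx ≠ z'.idx) : z ≠ z' := fun e => hz (congrArg idx e)
  have h₁ := h j (neg s) (by simp)
  have h₂ := h j t.bar (hne (by rw [idx_bar, idx_pos]; omega))
  have h₃ := h j t (hne (by rw [idx_pos]; omega))
  have h₄ (hj : j < s) := h j (pos s) (by simpa using hj.ne')
  have n₁ : neg s ≠ t.bar := hne (by simp [ht])
  have n₂ : t ≠ neg s := hne (by simp [ht])
  have n₃ : pos s ≠ t.bar := hne (by simp [ht])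
  simp only [upperSlot, true_and, n₁, n₁.symm, n₂, n₃, t.bar_ne_self.symm, reduceCtorEq,
    if_false, if_true] at h₁ h₂ h₃ h₄
  exact ⟨by omega, by omega, by omega, h₄⟩

theorem count_of_lowerSlot (h : Step (lowerSlot s t j) R R') (ht : t.idx = s + 1) (hjs : j ≤ s) :
    (R' j).count t = (R j).count t + 1 ∧ (R' j).count (neg s) = (R j).count (neg s) ∧
      (R' j).count t.bar = (R j).count t.bar ∧
      (j < s → (R' j).count (pos s) + 1 = (R j).count (pos s)) := by
  have hne {z z' : Letter} (hz : z.idx ≠ z'.idx) : z ≠ z' := fun e => hz (congrArg idx e)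
  have h₁ := h j (neg s) (by simp)
  have h₂ := h j t.bar (hne (by rw [idx_bar, idx_pos]; omega))
  have h₃ := h j t (hne (by rw [idx_pos]; omega))
  have h₄ (hj : j < s) := h j (pos s) (by simpa using hj.ne')
  have n₁ : t.bar ≠ pos s := hne (by simp [ht])
  have n₂ : t ≠ pos s := hne (by simp [ht])
  have n₃ : neg s ≠ t := hne (by simp [ht])
  simp only [lowerSlot, true_and, n₁, n₂, n₂.symm, n₃, t.bar_ne_self, reduceCtorEq,
    if_false, if_true] at h₁ h₂ h₃ h₄
  exact ⟨h₃, h₁, h₂, h₄⟩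

end Step

theorem IsESlot.rowSig_row (hσ : IsESlot s t R' σ) (ht : t.idx = s + 1) (h : Step σ R R') :
    (rowSig R' s t σ.row).closing = (rowSig R s t σ.row).closing + 1 ∧
      (σ.row < s → (rowSig R s t σ.row).opening = (rowSig R' s t σ.row).opening + 1) := by
  have hjs := hσ.isSlot.2.1
  rcases hσ.arrow with ⟨e, harrow⟩ | ⟨e, harrow⟩ <;> generalize σ.row = j at * <;> subst e
  · have := h.count_of_upperSlot ht hjs
    simp only [rowSig]
    omega
  · have := h.count_of_lowerSlot ht hjs
    simp only [rowSig]
    omega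

theorem IsESlot.isFSlot (hσ : IsESlot s t R' σ) (ht : t.idx = s + 1) (h : Step σ R R') :
    IsFSlot s t R σ := by
  have hrows {k : ℕ} (hk : k < s) (hne : k ≠ σ.row) : rowSig R s t k = rowSig R' s t k :=
    h.rowSig_of_ne hk (by omega) hne
  have hmem {k : ℕ} (hk : k ∈ List.range' 1 (s - 1)) : k < s := by
    have := List.mem_range'_1.1 hk
    omega
  have hjs := hσ.isSlot.2.1
  obtain ⟨hclosing, hopening⟩ := hσ.rowSig_row ht h
  refine ⟨hσ.isSlot, ?_, ?_⟩
  · rcases hσ.row with hrow | ⟨hs, hrow⟩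
    · have hlt := hmem hrow.mem
      have hflip : Flip (rowSig R s t) (rowSig R' s t) (List.range' 1 (s - 1)) σ.row :=
        ⟨hclosing, hopening hlt, fun k hk => hrows (hmem hk)⟩
      rw [h.rowSig_closing_of_ne ht hlt.ne']
      exact Or.inl ((hflip.firstOpening_iff_lastClosing (List.nodup_range' _)).2 hrow)
    · have hmap : (List.range' 1 (s - 1)).map (rowSig R s t) =
          (List.range' 1 (s - 1)).map (rowSig R' s t) :=
        List.map_congr_left fun k hk => hrows (hmem hk) ((hmem hk).trans_eq hs.symm).ne
      rw [hs] at hclosing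
      exact Or.inr ⟨hs, by rw [hmap]; omega⟩
  · refine hσ.arrow.imp (fun ⟨e, _⟩ => ⟨e, ?_⟩) fun ⟨e, _⟩ => ⟨e, ?_⟩
    · have := (e ▸ h).count_of_upperSlot ht hjs
      omega
    · have := (e ▸ h).count_of_lowerSlot ht hjs
      omega

namespace Arrows

theorem tabEps_eq (h : Arrows n i s t) (T : MLT n) : tabEps n i T.1 =
    (((List.range' 1 (s - 1)).map (rowSig T.1 s t)).prod • (rowSig T.1 s t s).closing : ℕ) := by
  obtain ⟨Y, hY, hlt⟩ := h.exists_brackets_eq T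
  change ((signature (brackets n i T.1)).closing : ℤ) = _
  rw [hY, signature_append, Bicyclic.closing_mul, signature_rowBlock_append hlt]
  simp only [signature_flatMap, signature_rowBlock]

theorem exists_tabF (h : Arrows n i s t) (hσ : IsFSlot s t T.1 σ) :
    ∃ T', tabF n i T = some T' ∧ Step σ T.1 T'.1 := by
  obtain ⟨Y, hY, hlt⟩ := h.exists_brackets_eq T
  exact h.exists_tabF_of_head? hσ.isSlot (hσ.source_pos (Nat.zero_lt_of_lt hlt))
    (hσ.arrow.imp_left And.left) (by rw [hY, hσ.head?_uncanceled hlt])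

theorem exists_tabE (h : Arrows n i s t) (hσ : IsESlot s t T.1 σ) :
    ∃ T', tabE n i T = some T' ∧ Step σ T'.1 T.1 := by
  obtain ⟨Y, hY, hlt⟩ := h.exists_brackets_eq T
  exact h.exists_tabE_of_getLast? hσ.isSlot hσ.target_pos (hσ.arrow.imp_right And.left)
    (by rw [hY, hσ.getLast?_uncanceled hlt])

theorem tabF_of_tabE (h : Arrows n i s t) (hT : tabE n i T = some T') : tabF n i T' = some T := by
  have hne : ((List.range' 1 (s - 1)).map (rowSig T.1 s t)).prod • (rowSig T.1 s t s).closing ≠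
      0 := by
    intro h0
    have := h.tabEps_eq T
    rw [h0, tabEps, Nat.cast_inj, List.length_eq_zero_iff] at this
    simp [tabE, this] at hT
  obtain ⟨σ, hσ⟩ := exists_isESlot h.one_le hne
  obtain ⟨T₁, hT₁, hstep⟩ := h.exists_tabE hσ
  obtain rfl := Option.some.inj (hT.symm.trans hT₁)
  obtain ⟨T₂, hT₂, hstep'⟩ := h.exists_tabF (hσ.isFSlot h.idx_target hstep)
  rw [hT₂, hstep'.mlt_ext hstep]

theorem tabEps_eq_zero (h : Arrows n i s t) (hT : tabE n i T = none) : tabEps n i T.1 = 0 := by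
  by_contra hne
  rw [h.tabEps_eq, Nat.cast_eq_zero] at hne
  obtain ⟨σ, hσ⟩ := exists_isESlot h.one_le hne
  obtain ⟨T₁, hT₁, -⟩ := h.exists_tabE hσ
  simp [hT] at hT₁

end Arrows

end Rows

/-! ### The coefficients of the image of a tableau -/

/-- The number of pairs `k, k̄` in a row `r` in position `j`. The letters `j̄` count as paired, the
letters `j` being placeholders. -/
def pairCount (r : List Letter) (j k : ℕ) : ℕ :=
  if k = j then r.count (neg j) else pairs r k

/-- The multiplicity of `root n j z` in the image of a row `r` in position `j`: the pairs of index
`z.idx - 1` and the unpaired letters `z` contribute. -/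
def rowMult (r : List Letter) (j : ℕ) (z : Letter) : ℕ :=
  pairCount r j (z.idx - 1) + (r.count z - pairCount r j z.idx)

theorem sum_Icc_pred {M : Type*} [AddCommMonoid M] {j n : ℕ} (f : ℕ → M) (hj : j < n) :
    ∑ k ∈ Finset.Icc (j + 1) n, f (k - 1) = f j + ∑ k ∈ Finset.Icc (j + 1) (n - 1), f k := by
  obtain ⟨n, rfl⟩ : ∃ m, n = m + 1 := ⟨n - 1, by omega⟩
  rw [← Finset.map_add_right_Icc, Finset.sum_map, Finset.Icc_add_one_left_eq_Ioc,
    Finset.add_sum_Ioc_eq_sum_Icc (by omega)]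
  rfl

section Coefficients

variable {n j : ℕ} {z : Letter} {r : List Letter}

theorem pairCount_self (r : List Letter) (j : ℕ) : pairCount r j j = r.count (neg j) := if_pos rfl

theorem pairCount_idx (hz : j < z.idx) :
    pairCount r j z.idx = min (r.count z) (r.count z.bar) := by
  rw [pairCount, if_neg hz.ne', pairs]
  cases z
  · rfl
  · exact min_comm _ _

theorem pairCount_le_count (hz : j < z.idx) : pairCount r j z.idx ≤ r.count z :=
  (pairCount_idx hz).trans_le (min_le_left _ _)

theorem rowMult_eq (hz : j < z.idx) :
    rowMult r j z = pairCount r j (z.idx - 1) + (r.count z - r.count z.bar) := by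
  rw [rowMult, pairCount_idx hz, tsub_min]

theorem pairCount_pred_eq_min {k : ℕ} (hk : j < k) :
    pairCount r j (k - 1) = min (rowMult r j (pos k)) (rowMult r j (neg k)) := by
  rw [rowMult_eq (z := pos k) hk, rowMult_eq (z := neg k) hk, bar_pos, bar_neg, idx_pos, idx_neg]
  omega

theorem IsRowAt.pairCount_last (hr : IsRowAt n j r) (hj : j < n) : pairCount r j n = 0 := by
  have hnot : ¬ (pos n ∈ r ∧ neg n ∈ r) := fun ⟨hp, hm⟩ =>
    Letter.noConfusion (hr.eq_of_height_eq hp hm (by simp only [Letter.height]; omega))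
  rw [← List.count_pos_iff, ← List.count_pos_iff] at hnot
  have : pairCount r j n = min (r.count (pos n)) (r.count (neg n)) := pairCount_idx (z := pos n) hj
  omega

theorem psiRow_eq_sum (r : List Letter) (hj : j < n) : psiRow n j r = ∑ k ∈ Finset.Icc (j + 1) n,
    (rowMult r j (pos k) • part n (root n j (pos k)) +
      rowMult r j (neg k) • part n (root n j (neg k))) := by
  have hpairs : r.count (neg j) • (part n (beta n j j) + part n (gamma n j (j + 1))) +
      ∑ k ∈ Finset.Icc (j + 1) (n - 1),
        pairs r k • (part n (beta n j k) + part n (gamma n j (k + 1))) =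
      ∑ k ∈ Finset.Icc (j + 1) n, pairCount r j (k - 1) •
        (part n (root n j (pos k)) + part n (root n j (neg k))) := by
    have hshift := sum_Icc_pred (fun k => pairCount r j k •
      (part n (root n j (pos (k + 1))) + part n (root n j (neg (k + 1))))) hj
    rw [pairCount_self] at hshift
    simp only [beta_eq_root, gamma_eq_root]
    refine Eq.trans (congrArg _ (Finset.sum_congr rfl fun k hk => ?_)) (hshift.symm.trans
      (Finset.sum_congr rfl fun k hk => ?_)) <;> have hk := (Finset.mem_Icc.1 hk).1
    · rw [pairCount, if_neg (by omega)]
    · rw [Nat.sub_add_cancel (by omega)]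
  have hunpaired (k) (hk : k ∈ Finset.Icc (j + 1) n) :
      (r.count (pos k) - pairs r k) • part n (beta n j (k - 1)) +
        (r.count (neg k) - pairs r k) • part n (gamma n j k) =
      (r.count (pos k) - pairCount r j k) • part n (root n j (pos k)) +
        (r.count (neg k) - pairCount r j k) • part n (root n j (neg k)) := by
    have hk := (Finset.mem_Icc.1 hk).1
    rw [beta_eq_root, gamma_eq_root, Nat.sub_add_cancel (by omega), pairCount, if_neg (by omega)]
  rw [psiRow, hpairs, add_assoc, ← Finset.sum_add_distrib, Finset.sum_congr rfl hunpaired,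
    ← Finset.sum_add_distrib]
  refine Finset.sum_congr rfl fun k _ => ?_
  simp only [rowMult, idx_pos, idx_neg, add_smul, smul_add]
  abel

theorem mult_psiRow (r : List Letter) {m : ℕ} (hj : 1 ≤ j) (hjn : j < n) (hz : IsRoot n m z) :
    mult n m z (psiRow n j r) = if m = j then rowMult r j z else 0 := by
  have hterm (k) (hk : k ∈ Finset.Icc (j + 1) n) :
      mult n m z (rowMult r j (pos k) • part n (root n j (pos k)) +
        rowMult r j (neg k) • part n (root n j (neg k))) =
      if k = z.idx then if m = j then rowMult r j z else 0 else 0 := by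
    obtain ⟨hjk, hkn⟩ := Finset.mem_Icc.1 hk
    rw [map_add, map_nsmul, map_nsmul, mult_part hz (show IsRoot n j (pos k) from ⟨hj, hjk, hkn⟩),
      mult_part hz (show IsRoot n j (neg k) from ⟨hj, hjk, hkn⟩)]
    rcases eq_or_ne k z.idx with rfl | hk
    · cases z <;> simp
    · have hne {y : Letter} (hy : y.idx = k) : z ≠ y := fun e => hk (hy.symm.trans (e ▸ rfl))
      simp only [hne (idx_pos k), hne (idx_neg k), hk, and_false, if_false, smul_zero, add_zero]
  rw [psiRow_eq_sum r hjn, map_sum, Finset.sum_congr rfl hterm, Finset.sum_ite_eq']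
  by_cases hm : m = j
  · rw [if_pos (Finset.mem_Icc.2 ⟨hm ▸ hz.2.1, hz.2.2⟩)]
  · simp only [hm, if_false, ite_self]

theorem mult_psi (T : MLT n) (hz : IsRoot n j z) : mult n j z (psi n T) = rowMult (T.1 j) j z := by
  obtain ⟨hj, hjz, hzn⟩ := hz
  have hrow (k) (hk : k ∈ Finset.Icc 1 (n - 1)) :
      mult n j z (psiRow n k (T.1 k)) = if j = k then rowMult (T.1 k) k z else 0 := by
    obtain ⟨hk, hkn⟩ := Finset.mem_Icc.1 hk
    exact mult_psiRow _ hk (by omega) ⟨hj, hjz, hzn⟩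
  rw [psi, map_sum, Finset.sum_congr rfl hrow, Finset.sum_ite_eq,
    if_pos (Finset.mem_Icc.2 ⟨hj, by omega⟩)]

theorem IsRowAt.count_eq_of_rowMult_eq {r' : List Letter} (hr : IsRowAt n j r)
    (hr' : IsRowAt n j r') (hj : j < n)
    (h : ∀ z : Letter, j < z.idx → z.idx ≤ n → rowMult r j z = rowMult r' j z)
    (hz : z ≠ pos j) : r.count z = r'.count z := by
  have hpair {k : ℕ} (hjk : j ≤ k) (hkn : k ≤ n) : pairCount r j k = pairCount r' j k := by
    rcases hkn.lt_or_eq with hkn | rfl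
    · rw [← Nat.add_sub_cancel k 1, pairCount_pred_eq_min (by omega),
        pairCount_pred_eq_min (by omega), h (pos (k + 1)) (Nat.lt_succ_of_le hjk) hkn,
        h (neg (k + 1)) (Nat.lt_succ_of_le hjk) hkn]
    · rw [hr.pairCount_last hj, hr'.pairCount_last hj]
  by_cases hzj : j ≤ z.idx ∧ z.idx ≤ n
  · rcases hzj.1.lt_or_eq with hlt | e
    · have := h z hlt hzj.2
      rw [rowMult, rowMult, hpair (Nat.le_sub_one_of_lt hlt) (by omega), hpair hlt.le hzj.2] at this
      have := pairCount_le_count (r := r) hlt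
      have := pairCount_le_count (r := r') hlt
      have := hpair hlt.le hzj.2
      omega
    · obtain rfl : z = neg j := by cases z <;> simp_all
      simpa only [pairCount_self] using hpair le_rfl hj.le
  · rw [List.count_eq_zero.2 fun hm => hzj ⟨hr.le_idx z hm, hr.idx_le z hm⟩,
      List.count_eq_zero.2 fun hm => hzj ⟨hr'.le_idx z hm, hr'.idx_le z hm⟩]

theorem psi_injective (n : ℕ) : Function.Injective (psi n) := by
  refine fun T T' e => mlt_ext fun j z hz => ?_
  by_cases hj : 1 ≤ j ∧ j < n
  · refine (T.2.isRowAt j).count_eq_of_rowMult_eq (T'.2.isRowAt j) hj.2 (fun z hjz hzn => ?_) hz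
    rw [← mult_psi T ⟨hj.1, hjz, hzn⟩, ← mult_psi T' ⟨hj.1, hjz, hzn⟩, e]
  · rw [T.2.rows j hj, T'.2.rows j hj]

end Coefficients

/-! ### The weight of the image of a tableau -/

section Weight

variable {n j : ℕ} {r : List Letter}

theorem root_pos_self (n j : ℕ) : root n j (pos j) = 0 := by simp [root, Letter.weight]

theorem root_pos_add_root_neg (n j k : ℕ) :
    root n j (pos k) + root n j (neg k) = root n j (neg j) := by
  simp [root, Letter.weight]

theorem sum_map_eq_sum_count {M : Type*} [AddCommMonoid M] (f : Letter → M)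
    (hr : ∀ z ∈ r, j ≤ z.idx ∧ z.idx ≤ n) : (r.map f).sum = ∑ k ∈ Finset.Icc j n,
      (r.count (pos k) • f (pos k) + r.count (neg k) • f (neg k)) := by
  induction r with
  | nil => simp
  | cons y r ih =>
    obtain ⟨hy, hr⟩ := List.forall_mem_cons.1 hr
    have hsum : f y = ∑ k ∈ Finset.Icc j n, ((if y = pos k then 1 else 0) • f (pos k) +
        (if y = neg k then 1 else 0) • f (neg k)) := by
      rw [Finset.sum_eq_single_of_mem y.idx (Finset.mem_Icc.2 hy)]
      · cases y <;> simp
      · intro k _ hk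
        have hne {z : Letter} (hz : z.idx = k) : y ≠ z := fun e => hk (hz.symm.trans (e ▸ rfl))
        rw [if_neg (hne rfl), if_neg (hne rfl), zero_smul, zero_smul, add_zero]
    rw [List.map_cons, List.sum_cons, ih hr, hsum, ← Finset.sum_add_distrib]
    refine Finset.sum_congr rfl fun k _ => ?_
    simp only [List.count_cons, beq_iff_eq, add_smul]
    abel

theorem IsRowAt.sum_map_root (hr : IsRowAt n j r) (hj : j < n) :
    (r.map (root n j)).sum = r.count (neg j) • root n j (neg j) + ∑ k ∈ Finset.Icc (j + 1) n,
      (r.count (pos k) • root n j (pos k) + r.count (neg k) • root n j (neg k)) := by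
  rw [sum_map_eq_sum_count (root n j) fun z hz => ⟨hr.le_idx z hz, hr.idx_le z hz⟩,
    ← Finset.add_sum_Ioc_eq_sum_Icc hj.le, root_pos_self, smul_zero, zero_add,
    Finset.Icc_add_one_left_eq_Ioc]

theorem IsRowAt.sum_rowMult (hr : IsRowAt n j r) (hj : j < n) : ∑ k ∈ Finset.Icc (j + 1) n,
      (rowMult r j (pos k) • root n j (pos k) + rowMult r j (neg k) • root n j (neg k)) =
    (r.map (root n j)).sum := by
  have hterm (k) (hk : k ∈ Finset.Icc (j + 1) n) :
      rowMult r j (pos k) • root n j (pos k) + rowMult r j (neg k) • root n j (neg k) +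
        pairCount r j k • root n j (neg j) = pairCount r j (k - 1) • root n j (neg j) +
      (r.count (pos k) • root n j (pos k) + r.count (neg k) • root n j (neg k)) := by
    have hk := (Finset.mem_Icc.1 hk).1
    obtain ⟨p, hp⟩ := Nat.exists_eq_add_of_le (pairCount_le_count (r := r) (z := pos k) hk)
    obtain ⟨q, hq⟩ := Nat.exists_eq_add_of_le (pairCount_le_count (r := r) (z := neg k) hk)
    simp only [idx_pos, idx_neg] at hp hq
    rw [← root_pos_add_root_neg n j k, rowMult, rowMult, idx_pos, idx_neg, hp, hq,
      Nat.add_sub_cancel_left, Nat.add_sub_cancel_left]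
    simp only [add_smul, smul_add]
    abel
  have htop : ∑ k ∈ Finset.Icc (j + 1) n, pairCount r j k • root n j (neg j) =
      ∑ k ∈ Finset.Icc (j + 1) (n - 1), pairCount r j k • root n j (neg j) := by
    obtain ⟨n, rfl⟩ : ∃ m, n = m + 1 := ⟨n - 1, by omega⟩
    rw [Finset.sum_Icc_succ_top (by omega), hr.pairCount_last hj, zero_smul, add_zero,
      Nat.add_sub_cancel]
  have hsum := Finset.sum_congr rfl hterm
  rw [Finset.sum_add_distrib, htop,
    Finset.sum_add_distrib (f := fun k => pairCount r j (k - 1) • root n j (neg j)),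
    sum_Icc_pred (fun k => pairCount r j k • root n j (neg j)) hj, pairCount_self,
    add_right_comm, ← hr.sum_map_root hj] at hsum
  exact add_right_cancel hsum

theorem kpWt_psiRow (hr : IsRowAt n j r) (hj : 1 ≤ j) (hjn : j < n) :
    kpWt n (psiRow n j r) = (r.map fun z => z.weight n - ep n j).sum := by
  have hterm (k) (hk : k ∈ Finset.Icc (j + 1) n) :
      kpWtHom n (rowMult r j (pos k) • part n (root n j (pos k)) +
        rowMult r j (neg k) • part n (root n j (neg k))) =
      -(rowMult r j (pos k) • root n j (pos k) + rowMult r j (neg k) • root n j (neg k)) := by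
    obtain ⟨hjk, hkn⟩ := Finset.mem_Icc.1 hk
    rw [map_add, map_nsmul, map_nsmul, kpWtHom_apply, kpWtHom_apply,
      kpWt_part (show IsRoot n j (pos k) from ⟨hj, hjk, hkn⟩),
      kpWt_part (show IsRoot n j (neg k) from ⟨hj, hjk, hkn⟩), smul_neg, smul_neg, neg_add]
  rw [psiRow_eq_sum r hjn, ← kpWtHom_apply, map_sum, Finset.sum_congr rfl hterm,
    Finset.sum_neg_distrib, hr.sum_rowMult hjn, List.sum_neg]
  simp [root, Function.comp_def]

theorem kpWt_psi (T : MLT n) : kpWt n (psi n T) = tabWt n T.1 := by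
  rw [psi, ← kpWtHom_apply, map_sum, tabWt]
  refine Finset.sum_congr rfl fun j hj => ?_
  obtain ⟨hj, hjn⟩ := Finset.mem_Icc.1 hj
  exact kpWt_psiRow (T.2.isRowAt j) hj (by omega)

end Weight

/-! ### Compatibility of `psi` with the operators -/

section Compatibility

variable {n i s j : ℕ} {t : Letter} {σ : Slot} {R R' : Filling} {T T' : MLT n}

namespace Arrows

theorem kpSig_psi_mul (h : Arrows n i s t) (T : MLT n) (hj : 1 ≤ j) (hjs : j < s) :
    kpSig n (psi n T) (lowerSlot s t j) * kpSig n (psi n T) (upperSlot s t j) =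
      rowSig T.1 s t j := by
  have hsn := h.lt.le
  have ht := h.idx_target
  have hpair : pairCount (T.1 j) j s = _ := pairCount_idx (z := pos s) hjs
  rw [bar_pos] at hpair
  simp only [kpSig, lowerSlot, upperSlot, mult_psi T (show IsRoot n j (pos s) from ⟨hj, hjs, hsn⟩),
    mult_psi T (show IsRoot n j (neg s) from ⟨hj, hjs, hsn⟩),
    mult_psi T (h.isRoot_target hj hjs.le), mult_psi T (h.isRoot_bar_target hj hjs.le),
    rowMult_eq (h.isRoot_target hj hjs.le).2.1, rowMult_eq (h.isRoot_bar_target hj hjs.le).2.1,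
    rowMult_eq (show j < (pos s).idx from hjs), rowMult_eq (show j < (neg s).idx from hjs),
    bar_pos, bar_neg, bar_bar, idx_bar, ht, idx_pos, idx_neg, Nat.add_sub_cancel, hpair]
  ext <;> simp only [Bicyclic.mul_closing, Bicyclic.mul_opening, rowSig] <;> omega

theorem prod_map_kpSig_psi (h : Arrows n i s t) (T : MLT n) :
    ((kpSlots s t).map (kpSig n (psi n T))).prod =
      ((List.range' 1 (s - 1)).map (rowSig T.1 s t)).prod := by
  rw [kpSlots, prod_map_flatMap_pair]
  refine congrArg _ (List.map_congr_left fun j hj => ?_)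
  obtain ⟨hj, hjs⟩ := List.mem_range'_1.1 hj
  exact h.kpSig_psi_mul T hj (by omega)

theorem mult_last_psi (h : Arrows n i s t) (T : MLT n) :
    mult n s t (psi n T) = (rowSig T.1 s t s).closing := by
  have hroot := h.isRoot_target h.one_le le_rfl
  rw [mult_psi T hroot, rowMult_eq hroot.2.1, h.idx_target, Nat.add_sub_cancel, pairCount_self,
    rowSig]

theorem kpEps_psi (h : Arrows n i s t) (T : MLT n) : kpEps n i (psi n T) = tabEps n i T.1 := by
  rw [h.kpEps_eq, h.tabEps_eq, h.prod_map_kpSig_psi, h.mult_last_psi]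

end Arrows

theorem Step.count_eq (h : Step σ R R') (hσ : IsSlot s t σ) (ht : t.idx = s + 1) {k : ℕ}
    {z : Letter} (hz : z ≠ pos k) (hne : k = σ.row → z.idx ≠ s ∧ z.idx ≠ s + 1) :
    (R' k).count z = (R k).count z := by
  have hidx : k = σ.row → z ≠ σ.source ∧ z ≠ σ.target := fun hk => by
    obtain ⟨h₁, h₂⟩ := hne hk
    constructor <;> rintro rfl <;> rcases hσ.2.2 with e | e <;> rw [e] at h₁ h₂ <;>
      simp [lowerSlot, upperSlot, ht] at h₁ h₂
  have := h k z hz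
  rwa [if_neg fun hk => (hidx hk.1).1 hk.2, if_neg fun hk => (hidx hk.1).2 hk.2] at this

namespace IsFSlot

theorem count_cases (hσ : IsFSlot s t R σ) (ht : t.idx = s + 1) (h : Step σ R R') :
    (R σ.row).count t < (R σ.row).count t.bar ∧
        (R' σ.row).count (neg s) = (R σ.row).count (neg s) + 1 ∧
        (R' σ.row).count t.bar + 1 = (R σ.row).count t.bar ∧
        (R' σ.row).count t = (R σ.row).count t ∧
        (σ.row < s → (R' σ.row).count (pos s) = (R σ.row).count (pos s)) ∨
      (R σ.row).count t.bar ≤ (R σ.row).count t ∧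
        (R' σ.row).count t = (R σ.row).count t + 1 ∧
        (R' σ.row).count (neg s) = (R σ.row).count (neg s) ∧
        (R' σ.row).count t.bar = (R σ.row).count t.bar ∧
        (σ.row < s → (R' σ.row).count (pos s) + 1 = (R σ.row).count (pos s)) := by
  rcases hσ.arrow with ⟨e, harrow⟩ | ⟨e, harrow⟩
  · exact Or.inl ⟨harrow, (e ▸ h).count_of_upperSlot ht hσ.isSlot.2.1⟩
  · exact Or.inr ⟨harrow, (e ▸ h).count_of_lowerSlot ht hσ.isSlot.2.1⟩

theorem pairCount_eq (hσ : IsFSlot s t R σ) (ht : t.idx = s + 1) (h : Step σ R R') {k m : ℕ}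
    (hkm : k ≤ m) (hne : k = σ.row → m ≠ s) :
    pairCount (R' k) k m = pairCount (R k) k m := by
  by_cases hm : k = σ.row ∧ m = s + 1
  · obtain ⟨rfl, rfl⟩ := hm
    rw [← ht, pairCount_idx (by have := hσ.isSlot.2.1; omega),
      pairCount_idx (by have := hσ.isSlot.2.1; omega)]
    have := hσ.count_cases ht h
    omega
  · have hcount {z : Letter} (hz : z.idx = m) (hzk : z ≠ pos k) :
        (R' k).count z = (R k).count z :=
      h.count_eq hσ.isSlot ht hzk fun hk => by
        rw [hz]
        exact ⟨hne hk, fun e => hm ⟨hk, e⟩⟩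
    rcases hkm.eq_or_lt with rfl | hkm
    · rw [pairCount_self, pairCount_self, hcount rfl (by simp)]
    · have hneg := hcount (z := neg m) rfl (by simp)
      have hpos := hcount (z := pos m) rfl (by simpa using hkm.ne')
      rw [← idx_pos m, pairCount_idx hkm, pairCount_idx hkm, bar_pos, hneg, hpos]

theorem rowMult_eq (hσ : IsFSlot s t R σ) (ht : t.idx = s + 1) (h : Step σ R R') {k : ℕ}
    {z : Letter} (hz : k < z.idx) (hne : k = σ.row → z.idx ≠ s ∧ z.idx ≠ s + 1) :
    rowMult (R' k) k z = rowMult (R k) k z := by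
  rw [rowMult, rowMult, hσ.pairCount_eq ht h (Nat.le_sub_one_of_lt hz) fun hk => by
    have := hne hk; omega, hσ.pairCount_eq ht h hz.le fun hk => (hne hk).1,
    h.count_eq hσ.isSlot ht (by rintro rfl; exact hz.false) hne]

theorem rowMult_row_eq (hσ : IsFSlot s t R σ) (ht : t.idx = s + 1) (h : Step σ R R')
    (hs : σ.row = s) {z : Letter} (hz : s < z.idx) :
    rowMult (R' s) s z = rowMult (R s) s z + if z = t then 1 else 0 := by
  by_cases hzt : z.idx = t.idx
  · have hcount := hσ.count_cases ht h
    rw [hs] at hcount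
    rw [TypeD.rowMult_eq hz, TypeD.rowMult_eq hz, hzt, ht, Nat.add_sub_cancel, pairCount_self,
      pairCount_self]
    rcases eq_or_eq_bar_of_idx_eq hzt with rfl | rfl
    · rw [if_pos rfl]
      omega
    · rw [if_neg t.bar_ne_self, bar_bar]
      omega
  · rw [if_neg fun e => hzt (congrArg idx e), add_zero,
      hσ.rowMult_eq ht h hz fun _ => ⟨hz.ne', ht ▸ hzt⟩]

end IsFSlot

/-- The slot in which `f_i` acts on `psi n ⟨R, _⟩` if it acts in row `j < s` of `R`. -/
def psiSlot (s : ℕ) (t : Letter) (R : Filling) (j : ℕ) : Slot :=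
  if (R j).count (neg s) < (R j).count (pos s) then lowerSlot s t j else upperSlot s t j

theorem psiSlot_cases (s : ℕ) (t : Letter) (R : Filling) (j : ℕ) :
    (R j).count (neg s) < (R j).count (pos s) ∧ psiSlot s t R j = lowerSlot s t j ∨
      (R j).count (pos s) ≤ (R j).count (neg s) ∧ psiSlot s t R j = upperSlot s t j := by
  rw [psiSlot]
  split_ifs with h
  · exact Or.inl ⟨h, rfl⟩
  · exact Or.inr ⟨not_lt.1 h, rfl⟩

theorem psiSlot_row (s : ℕ) (t : Letter) (R : Filling) (j : ℕ) : (psiSlot s t R j).row = j := by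
  rcases psiSlot_cases s t R j with ⟨-, e⟩ | ⟨-, e⟩ <;> rw [e] <;> rfl

namespace IsFSlot

theorem rowMult_psiSlot (hσ : IsFSlot s t R σ) (ht : t.idx = s + 1) (h : Step σ R R')
    (hs : σ.row < s) {z : Letter} (hz : σ.row < z.idx) :
    rowMult (R' σ.row) σ.row z + (if z = (psiSlot s t R σ.row).source then 1 else 0) =
      rowMult (R σ.row) σ.row z + if z = (psiSlot s t R σ.row).target then 1 else 0 := by
  have hne {x y : Letter} (hxy : x.idx ≠ y.idx) : x ≠ y := fun e => hxy (congrArg idx e)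
  have hpred := hσ.pairCount_eq ht h (Nat.le_sub_one_of_lt hs) fun _ => by omega
  have hpair (R : Filling) := pairCount_idx (r := R σ.row) (z := pos s) hs
  simp only [idx_pos, bar_pos] at hpair
  have hcount := hσ.count_cases ht h
  by_cases hzs : z.idx = s
  · have hzt : z ≠ t ∧ z ≠ t.bar := ⟨hne (by omega), hne (by rw [idx_bar]; omega)⟩
    rw [TypeD.rowMult_eq hz, TypeD.rowMult_eq hz, hzs, hpred]
    have hz' : z = pos s ∨ z = neg s := eq_or_eq_bar_of_idx_eq hzs
    rcases hz' with rfl | rfl <;>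
      rcases psiSlot_cases s t R σ.row with ⟨hle, e⟩ | ⟨hle, e⟩ <;> rw [e] <;>
      simp only [lowerSlot, upperSlot, bar_pos, bar_neg, hzt, reduceCtorEq, if_true, if_false] <;>
      omega
  by_cases hzt : z.idx = t.idx
  · have hzs' : z ≠ pos s ∧ z ≠ neg s := ⟨hne hzs, hne hzs⟩
    rw [TypeD.rowMult_eq hz, TypeD.rowMult_eq hz, hzt, ht, Nat.add_sub_cancel, hpair, hpair]
    rcases psiSlot_cases s t R σ.row with ⟨hle, e⟩ | ⟨hle, e⟩ <;> rw [e] <;>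
      rcases eq_or_eq_bar_of_idx_eq hzt with rfl | rfl <;>
      simp only [lowerSlot, upperSlot, bar_bar, hzs', bar_ne_self, Ne.symm (bar_ne_self _),
        if_true, if_false] <;>
      omega
  · rw [if_neg, if_neg, hσ.rowMult_eq ht h hz fun _ => ⟨hzs, ht ▸ hzt⟩]
    · rcases psiSlot_cases s t R σ.row with ⟨-, e⟩ | ⟨-, e⟩ <;> rw [e] <;>
        exact hne (by simpa [lowerSlot, upperSlot])
    · rcases psiSlot_cases s t R σ.row with ⟨-, e⟩ | ⟨-, e⟩ <;> rw [e] <;>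
        exact hne (by simpa [lowerSlot, upperSlot])

end IsFSlot

namespace Arrows

theorem psiSlot_mem_kpSlots (s : ℕ) (t : Letter) (R : Filling) (hj : 1 ≤ j) (hjs : j < s) :
    psiSlot s t R j ∈ kpSlots s t :=
  mem_kpSlots.2 ⟨j, hj, hjs,
    (psiSlot_cases s t R j).imp And.right And.right⟩

theorem psi_eq_move (h : Arrows n i s t) (hσ : IsFSlot s t T.1 σ) (hstep : Step σ T.1 T'.1)
    (hs : σ.row < s) : psi n T' = move n (psi n T)
      (root n σ.row (psiSlot s t T.1 σ.row).source)
      (root n σ.row (psiSlot s t T.1 σ.row).target) := by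
  obtain ⟨hsource, htarget⟩ :=
    h.isRoot_of_mem_kpSlots (psiSlot_mem_kpSlots s t T.1 hσ.isSlot.1 hs)
  have hne := h.source_ne_target
    (isSlot_of_mem_kpSlots (psiSlot_mem_kpSlots s t T.1 hσ.isSlot.1 hs))
  rw [psiSlot_row] at hsource htarget
  refine ext_mult fun k z hz => ?_
  rw [mult_move _ hz hsource htarget, mult_psi T hz, mult_psi T' hz]
  by_cases hk : k = σ.row
  · subst hk
    have := hσ.rowMult_psiSlot h.idx_target hstep hs hz.2.1
    simp only [true_and]
    split_ifs at this ⊢ with h₁ h₂ <;> first | omega | exact absurd (h₁.symm.trans h₂) hne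
  · simp [hk, hσ.rowMult_eq h.idx_target hstep hz.2.1]

theorem psi_eq_add_part (h : Arrows n i s t) (hσ : IsFSlot s t T.1 σ) (hstep : Step σ T.1 T'.1)
    (hs : σ.row = s) : psi n T' = psi n T + part n (root n s t) := by
  refine ext_mult fun k z hz => ?_
  rw [map_add, mult_part hz (h.isRoot_target h.one_le le_rfl), mult_psi T hz, mult_psi T' hz]
  by_cases hk : k = s
  · subst hk
    simp only [true_and]
    exact hσ.rowMult_row_eq h.idx_target hstep hs hz.2.1
  · simp [hk, hσ.rowMult_eq h.idx_target hstep hz.2.1 fun e => absurd (e.trans hs) hk]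

theorem firstOpening_psiSlot (h : Arrows n i s t)
    (hj : FirstOpening (rowSig T.1 s t) (List.range' 1 (s - 1)) (rowSig T.1 s t s).closing j) :
    FirstOpening (kpSig n (psi n T)) (kpSlots s t) (mult n s t (psi n T))
      (psiSlot s t T.1 j) := by
  have hmem {k : ℕ} (hk : k ∈ List.range' 1 (s - 1)) : 1 ≤ k ∧ k < s := by
    have := List.mem_range'_1.1 hk
    omega
  obtain ⟨hj₁, hjs⟩ := hmem hj.mem
  have hrow := hj.congr fun k hk => (h.kpSig_psi_mul T (hmem hk).1 (hmem hk).2).symm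
  rw [h.mult_last_psi]
  have hroot (z : Letter) (hz : z.idx = s) : IsRoot n j z := by
    rw [IsRoot, hz]
    exact ⟨hj₁, hjs, h.lt.le⟩
  have hpos := mult_psi T (hroot (pos s) rfl)
  have hneg := mult_psi T (hroot (neg s) rfl)
  rw [rowMult_eq (hroot _ rfl).2.1] at hpos hneg
  simp only [idx_pos, idx_neg, bar_pos, bar_neg] at hpos hneg
  rcases psiSlot_cases s t T.1 j with ⟨hlt, e⟩ | ⟨hle, e⟩ <;> rw [e]
  · refine hrow.fst_of_row ?_
    simp only [kpSig, lowerSlot, upperSlot]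
    omega
  · refine hrow.snd_of_row ?_
    simp only [kpSig, lowerSlot, upperSlot]
    omega

theorem kpF_psi (h : Arrows n i s t) (hσ : IsFSlot s t T.1 σ) (hstep : Step σ T.1 T'.1) :
    kpF n i (psi n T) = psi n T' := by
  rcases hσ.row with hrow | ⟨hs, hle⟩
  · have hs : σ.row < s := by
      have := List.mem_range'_1.1 hrow.mem
      omega
    rw [h.psi_eq_move hσ hstep hs, h.kpF_slot (h.firstOpening_psiSlot hrow), psiSlot_row]
  · rw [h.psi_eq_add_part hσ hstep hs, h.kpF_last]
    rwa [h.prod_map_kpSig_psi, h.mult_last_psi]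

theorem map_psi_tabF (h : Arrows n i s t) (T : MLT n) :
    (tabF n i T).map (psi n) = some (kpF n i (psi n T)) := by
  obtain ⟨σ, hσ⟩ := exists_isFSlot h.one_le t T.1
  obtain ⟨T', hT', hstep⟩ := h.exists_tabF hσ
  rw [hT', Option.map_some, h.kpF_psi hσ hstep]

theorem map_psi_tabE (h : Arrows n i s t) (T : MLT n) :
    (tabE n i T).map (psi n) = kpE n i (psi n T) := by
  cases hT : tabE n i T with
  | none =>
    have heps := h.tabEps_eq_zero hT
    rw [← h.kpEps_psi, h.kpEps_eq, Nat.cast_eq_zero] at heps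
    rw [Option.map_none, h.kpE_none heps]
  | some T' =>
    have hF := h.map_psi_tabF T'
    rw [h.tabF_of_tabE hT, Option.map_some, Option.some_inj] at hF
    rw [Option.map_some, hF, h.kpE_kpF]

end Arrows

end Compatibility

/-! ### The isomorphism -/

/-- The highest weight element of `MLT n`: the tableau all of whose letters are placeholders. -/
def emptyTableau (n : ℕ) : Filling :=
  fun j => if 1 ≤ j then List.replicate (n - j) (pos j) else []

section EmptyTableau

variable {n j : ℕ}

theorem isMarginallyLarge_emptyTableau (n : ℕ) : IsMarginallyLarge n (emptyTableau n) := by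
  refine isMarginallyLarge_iff.2 ⟨fun j hj => ?_, fun j => ?_, fun j hj hjn => ?_⟩
  · rw [emptyTableau, ite_eq_right_iff, List.replicate_eq_nil_iff]
    omega
  · have hmem {z : Letter} (hz : z ∈ emptyTableau n j) : z = pos j ∧ j < n := by
      rw [emptyTableau] at hz
      split_ifs at hz
      · obtain ⟨hne, hz⟩ := List.mem_replicate.1 hz
        exact ⟨hz, by omega⟩
      · simp at hz
    refine ⟨List.pairwise_of_forall_mem_list fun x hx y hy => Or.inl ?_, fun z hz => ?_,
      fun z hz => ?_⟩
    · rw [(hmem hx).1, (hmem hy).1]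
    · rw [(hmem hz).1, idx_pos]
    · rw [(hmem hz).1, idx_pos]
      exact (hmem hz).2.le
  · rw [emptyTableau, emptyTableau, if_pos hj, if_pos (Nat.le_add_left 1 j),
      List.count_replicate_self, List.length_replicate]
    omega

theorem count_emptyTableau {z : Letter} (hz : z ≠ pos j) : (emptyTableau n j).count z = 0 := by
  rw [emptyTableau]
  split_ifs
  · rw [List.count_replicate, if_neg (by simpa using hz.symm)]
  · rfl

theorem psi_emptyTableau (n : ℕ) : psi n ⟨_, isMarginallyLarge_emptyTableau n⟩ = 0 := by
  refine ext_mult fun j z hz => ?_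
  have hpair (k : ℕ) : pairCount (emptyTableau n j) j k = 0 := by
    rw [pairCount, pairs, count_emptyTableau (z := neg k) (by simp),
      count_emptyTableau (z := neg j) (by simp), Nat.min_zero, ite_self]
  have hzj : z ≠ pos j := by
    rintro rfl
    exact hz.2.1.false
  rw [mult_psi _ hz, map_zero, rowMult, hpair, hpair, count_emptyTableau hzj, Nat.sub_zero,
    add_zero]

end EmptyTableau

theorem psi_surjective {n : ℕ} (hn : 2 ≤ n) : Function.Surjective (psi n) := by
  refine kp_induction hn ⟨_, psi_emptyTableau n⟩ ?_
  rintro i - hi hin ⟨T, rfl⟩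
  obtain ⟨s, t, h⟩ := exists_arrows hn hi hin
  obtain ⟨T', -, hT'⟩ := Option.map_eq_some_iff.1 (h.map_psi_tabF T)
  exact ⟨T', hT'⟩

theorem psi_isCrystalIso {n : ℕ} (hn : 2 ≤ n) :
    IsCrystalIso (tabCrystal n) (kpCrystal n) (psi n) where
  bijective := ⟨psi_injective n, psi_surjective hn⟩
  wt_eq := kpWt_psi
  eps_eq i hi hin T := by
    obtain ⟨s, t, h⟩ := exists_arrows hn hi hin
    exact h.kpEps_psi T
  phi_eq i hi hin T := by
    obtain ⟨s, t, h⟩ := exists_arrows hn hi hin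
    exact congrArg₂ (fun ε w => ε + pairing n i w) (h.kpEps_psi T) (kpWt_psi T)
  e_eq i hi hin T := by
    obtain ⟨s, t, h⟩ := exists_arrows hn hi hin
    exact (h.map_psi_tabE T).symm
  f_eq i hi hin T := by
    obtain ⟨s, t, h⟩ := exists_arrows hn hi hin
    exact (h.map_psi_tabF T).symm

theorem IsCrystalIso.isCrystal {n : ℕ} {X Y : Type} {C : CrystalData n X} {D : CrystalData n Y}
    {F : X → Y} (hF : IsCrystalIso C D F) (hD : D.IsCrystal) : C.IsCrystal := by
  have he {i : ℕ} (hi : 1 ≤ i) (hin : i ≤ n) (b b' : X) :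
      C.e i b = some b' ↔ D.e i (F b) = some (F b') := by
    rw [hF.e_eq i hi hin, ← Option.map_some, (Option.map_injective hF.bijective.1).eq_iff]
  have hf {i : ℕ} (hi : 1 ≤ i) (hin : i ≤ n) (b b' : X) :
      C.f i b = some b' ↔ D.f i (F b) = some (F b') := by
    rw [hF.f_eq i hi hin, ← Option.map_some, (Option.map_injective hF.bijective.1).eq_iff]
  refine ⟨fun i hi hin b => ?_, fun i hi hin b b' e => ?_, fun i hi hin b b' e => ?_,
    fun i hi hin b b' => ?_⟩
  · rw [← hF.phi_eq i hi hin, ← hF.eps_eq i hi hin, ← hF.wt_eq, hD.phi_eq i hi hin]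
  · simpa only [hF.wt_eq, hF.eps_eq i hi hin, hF.phi_eq i hi hin] using
      hD.of_e i hi hin _ _ ((he hi hin b b').1 e)
  · simpa only [hF.wt_eq, hF.eps_eq i hi hin, hF.phi_eq i hi hin] using
      hD.of_f i hi hin _ _ ((hf hi hin b b').1 e)
  · rw [hf hi hin, he hi hin]
    exact hD.f_iff_e i hi hin _ _

end TypeD

theorem theorem3p1 (n : ℕ) (hn : 2 ≤ n) :
    (TypeD.tabCrystal n).IsCrystal ∧ (TypeD.kpCrystal n).IsCrystal ∧
      TypeD.IsCrystalIso (TypeD.tabCrystal n) (TypeD.kpCrystal n) (TypeD.psi n) ∧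
      ∀ F : TypeD.MLT n → TypeD.Kp n,
        TypeD.IsCrystalIso (TypeD.tabCrystal n) (TypeD.kpCrystal n) F → F = TypeD.psi n := by
  have hkp := TypeD.kpCrystal_isCrystal hn
  have hpsi := TypeD.psi_isCrystalIso hn
  exact ⟨hpsi.isCrystal hkp, hkp, hpsi, fun F hF => TypeD.crystalIso_unique hn hF hpsi⟩
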